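/- Let $\Omega\subset\mathbb R^2\cong\mathbb C$ be a bounded, simply connected domain whose boundary $\Gamma=\partial\Omega$ is of class $C^{3,\alpha}$ for some $\alpha\in(0,1]$, and let $g:\Gamma\to\mathbb S^1$ be of class $C^{3,\alpha}$ with positive degree $\mathcal D:=\deg(g;\Gamma)>0$, where $\Gamma$ is positively oriented. Write $g^\perp=ig$. For $\varepsilon>0$, $s\in(0,1]$ and $u\in H^1(\Omega;\mathbb R^2)$ set $$E_\varepsilon(u)=\frac12\int_\Omega\Big(|\nabla u|^2+\frac1{2\varepsilon^2}(1-|u|^2)^2\Big)dx,\qquad E^{g,s}_\varepsilon(u)=E_\varepsilon(u)+\frac1{2\varepsilon^s}\int_\Gamma\langle u,g^\perp\rangle^2\,ds,$$ and let $\mathcal H_g(\Omega)=\{u\in H^1(\Omega;\mathbb R^2):\langle u,g^\perp\rangle=0\text{ on }\Gamma\}$, where boundary values are understood in the sense of traces. Then the following hold. 1. There is a constant $C>0$, independent of $\varepsilon$, such that for every $\varepsilon>0$ and every minimizer $u_\varepsilon$ of $E_\varepsilon$ over $\mathcal H_g(\Omega)$, $$E_\varepsilon(u_\varepsilon)\le\pi\mathcal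 D|\ln\varepsilon|+C.$$ 2. For every $s\in(0,1]$ there is a constant $C>0$, independent of $\varepsilon$, such that for every $\varepsilon>0$ and every minimizer $u_\varepsilon$ of $E^{g,s}_\varepsilon$ over $H^1(\Omega;\mathbb R^2)$, $$E^{g,s}_\varepsilon(u_\varepsilon)\le\pi s\mathcal D|\ln\varepsilon|+C.$$ -/

import Mathlib

open MeasureTheory Filter Topology Set
open scoped NNReal ENNReal ContDiff

noncomputable section

namespace TangentialGL

/-- Functions of class `C^{3,α}`: three times continuously differentiable, with `α`-Hölder
third derivative. -/
def IsC3Holder {E F : Type*} [NormedAddCommGroup E] [NormedSpace ℝ E]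
    [NormedAddCommGroup F] [NormedSpace ℝ F] (α : ℝ≥0) (f : E → F) : Prop :=
  ContDiff ℝ 3 f ∧ ∃ K : ℝ≥0, HolderWith K α (iteratedFDeriv ℝ 3 f)

/-- The boundary of `Ω` is of class `C^{3,α}`: near each of its points `p`, after a rotation by
the unit number `c`, the set `Ω` is the part of a disc that lies above the graph of a `C^{3,α}`
function. -/
def HasC3HolderBoundary (α : ℝ≥0) (Ω : Set ℂ) : Prop :=
  ∀ p ∈ frontier Ω, ∃ (c : ℂ) (r : ℝ) (f : ℝ → ℝ), ‖c‖ = 1 ∧ 0 < r ∧ IsC3Holder α f ∧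
    ∀ z ∈ Metric.ball p r, z ∈ Ω ↔ f ((z - p) / c).re < ((z - p) / c).im

/-- `g` restricts to a map of class `C^{3,α}` from the closed set `Γ` to the unit circle
(values off `Γ` are irrelevant). -/
def IsC3HolderCircleMap (α : ℝ≥0) (Γ : Set ℂ) (g : ℂ → ℂ) : Prop :=
  (∀ z ∈ Γ, ‖g z‖ = 1) ∧ ∃ G : ℂ → ℂ, IsC3Holder α G ∧ EqOn G g Γ

/-- `γ` is a regular simple closed `C^{3,α}` parametrization, with period `1`, of the boundary of
`Ω`, and it is positively oriented: `Ω` lies to the left of `γ`. -/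
structure IsPositiveBoundaryParam (α : ℝ≥0) (Ω : Set ℂ) (γ : ℝ → ℂ) : Prop where
  smooth : IsC3Holder α γ
  periodic : Function.Periodic γ 1
  injOn : InjOn γ (Ico 0 1)
  regular : ∀ t, deriv γ t ≠ 0
  range_eq : range γ = frontier Ω
  inward : ∀ t, ∀ᶠ r : ℝ in 𝓝[>] 0, γ t + r * (Complex.I * deriv γ t) ∈ Ω

/-- `deg(g; ∂Ω) = D`: along a positively oriented parametrization `γ` of the boundary,
`g ∘ γ = exp (i θ)` with a continuous phase `θ` that increases by `2 π D` over one period. -/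
def HasBoundaryDegree (α : ℝ≥0) (Ω : Set ℂ) (g : ℂ → ℂ) (D : ℤ) : Prop :=
  ∃ (γ : ℝ → ℂ) (θ : ℝ → ℝ), IsPositiveBoundaryParam α Ω γ ∧ Continuous θ ∧
    (∀ t, g (γ t) = Complex.exp (θ t * Complex.I)) ∧ θ 1 - θ 0 = 2 * Real.pi * D

/-- `w` is the weak derivative of `u` in the direction `e` on the open set `Ω`. -/
def IsWeakDeriv (Ω : Set ℂ) (e : ℂ) (u w : ℂ → ℂ) : Prop :=
  ∀ φ : ℂ → ℝ, ContDiff ℝ ∞ φ → HasCompactSupport φ → tsupport φ ⊆ Ω →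
    ∫ z in Ω, (fderiv ℝ φ z e) • u z = - ∫ z in Ω, φ z • w z

/-- An element of the Sobolev space `H¹(Ω; ℝ²)`, with `ℝ² ≅ ℂ`, together with (representatives of)
its weak partial derivatives. -/
structure H1 (Ω : Set ℂ) where
  toFun : ℂ → ℂ
  dx : ℂ → ℂ
  dy : ℂ → ℂ
  memLp_toFun : MemLp toFun 2 (volume.restrict Ω)
  memLp_dx : MemLp dx 2 (volume.restrict Ω)
  memLp_dy : MemLp dy 2 (volume.restrict Ω)
  weak_dx : IsWeakDeriv Ω 1 toFun dx
  weak_dy : IsWeakDeriv Ω Complex.I toFun dy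

/-- Arc length on the boundary of `Ω`, as the one-dimensional Hausdorff measure. -/
def bdryMeasure (Ω : Set ℂ) : Measure ℂ :=
  (Measure.hausdorffMeasure 1).restrict (frontier Ω)

/-- `T` is the boundary trace of `u ∈ H¹(Ω; ℝ²)`: the `L²(∂Ω)` limit of the boundary values of
`C¹` functions on the plane that converge to `u` in `H¹(Ω)`. -/
def IsTrace (Ω : Set ℂ) (u : H1 Ω) (T : ℂ → ℂ) : Prop :=
  MemLp T 2 (bdryMeasure Ω) ∧ ∃ φ : ℕ → ℂ → ℂ, (∀ n, ContDiff ℝ 1 (φ n)) ∧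
    Tendsto (fun n => eLpNorm (fun z => φ n z - u.toFun z) 2 (volume.restrict Ω)) atTop (𝓝 0) ∧
    Tendsto (fun n => eLpNorm (fun z => fderiv ℝ (φ n) z 1 - u.dx z) 2 (volume.restrict Ω))
      atTop (𝓝 0) ∧
    Tendsto (fun n => eLpNorm (fun z => fderiv ℝ (φ n) z Complex.I - u.dy z) 2
      (volume.restrict Ω)) atTop (𝓝 0) ∧
    Tendsto (fun n => eLpNorm (fun z => φ n z - T z) 2 (bdryMeasure Ω)) atTop (𝓝 0)

/-- The Ginzburg--Landau energy
`E_ε(u) = 1/2 ∫_Ω (|∇u|² + (1 - |u|²)² / (2 ε²))`, with values in `[0, ∞]`. -/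
def energy (Ω : Set ℂ) (ε : ℝ) (u : H1 Ω) : ℝ≥0∞ :=
  ENNReal.ofReal (1 / 2) * ∫⁻ z in Ω, ENNReal.ofReal
    (‖u.dx z‖ ^ 2 + ‖u.dy z‖ ^ 2 + 1 / (2 * ε ^ 2) * (1 - ‖u.toFun z‖ ^ 2) ^ 2)

/-- The component `⟨w, g^⊥⟩` of `w` along `g^⊥ = i g`. -/
def perpComp (g w : ℂ) : ℝ := inner ℝ w (Complex.I * g)

/-- The energy `E_ε^{g,s}(u) = E_ε(u) + 1/(2 ε^s) ∫_{∂Ω} ⟨u, g^⊥⟩² ds`, where `T` is the trace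
of `u`. -/
def weakEnergy (Ω : Set ℂ) (g : ℂ → ℂ) (s ε : ℝ) (u : H1 Ω) (T : ℂ → ℂ) : ℝ≥0∞ :=
  energy Ω ε u + ENNReal.ofReal (1 / (2 * ε ^ s)) *
    ∫⁻ z, ENNReal.ofReal (perpComp (g z) (T z) ^ 2) ∂(bdryMeasure Ω)

/-- The class `ℋ_g(Ω)` of all `u ∈ H¹(Ω; ℝ²)` with `⟨u, g^⊥⟩ = 0` on the boundary, in the sense
of traces. -/
def strongClass (Ω : Set ℂ) (g : ℂ → ℂ) : Set (H1 Ω) :=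
  {u | ∃ T, IsTrace Ω u T ∧ ∀ᵐ z ∂(bdryMeasure Ω), perpComp (g z) (T z) = 0}

/-- `u` minimizes `E_ε` over `ℋ_g(Ω)`. -/
def IsStrongMinimizer (Ω : Set ℂ) (g : ℂ → ℂ) (ε : ℝ) (u : H1 Ω) : Prop :=
  u ∈ strongClass Ω g ∧ ∀ v ∈ strongClass Ω g, energy Ω ε u ≤ energy Ω ε v

/-- `u`, with trace `T`, minimizes `E_ε^{g,s}` over `H¹(Ω; ℝ²)`. -/
def IsWeakMinimizer (Ω : Set ℂ) (g : ℂ → ℂ) (s ε : ℝ) (u : H1 Ω) (T : ℂ → ℂ) : Prop :=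
  IsTrace Ω u T ∧ ∀ (v : H1 Ω) (S : ℂ → ℂ), IsTrace Ω v S →
    weakEnergy Ω g s ε u T ≤ weakEnergy Ω g s ε v S

end TangentialGL

end

/-! A minimizer costs no more than any admissible map, so it is enough to exhibit one competitor
with the right energy. For `ε < 1` it carries `2D` vortices of degree one centred at, or just
outside, boundary points `p j`. At each of these points `Ω` lies in a half plane, so `Ω` sees at
most half of the vortex, which costs `(π/2)|ln η|` with core size `η` instead of `π|ln η|`;
altogether this is `πD|ln η|`.

The boundary condition holds because of Hopf's observation. For `z` running once along `∂Ω`, the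
line through `p j` and `z` turns by exactly `π` (`chord_phase_add_one`). Hence the product of `2D`
unit chord directions has winding number `D`, and `g` is this product times `exp (i ψ)` with a
single valued `C¹` phase `ψ` (`exists_boundaryFactorization`). With vortices exactly at the `p j`,
each vortex factor is on `∂Ω` a real multiple of its chord direction, so the competitor `exp (i ψ) ∏
vortex` is there a real multiple of `g` and belongs to the strong class; its core size is `ε`.

For the weak problem the vortices are pushed out of `Ω` by `δ = ε^s`. In `Ω` the logarithm is then
cut off at `ε^s`, which gives `πsD|ln ε|`. The component along `g^⊥` is no longer zero, but the
integral of its square over `∂Ω` is `O(δ)` (`exists_boundary_term_le`), which the weight `1/(2ε^s)`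
turns into a constant.

The interactions between distinct vortices, and with `∇ψ`, are bounded by multiples of `∑ 1/|z - p
j|`, which is integrable in the plane. The potential is controlled by kernels `ε²/(|z - q|² + ε²)²`
with integral at most `π`. -/

namespace TangentialGL

/-! ### Chords of a simple closed curve and their phases -/

/-- Hadamard's lemma in one variable: a `C²` curve minus its value at `a` is `t - a` times a `C¹`
curve. -/
theorem exists_contDiff_one_sub_eq_mul {f : ℝ → ℂ} (hf : ContDiff ℝ 2 f) (a : ℝ) :
    ∃ h : ℝ → ℂ, ContDiff ℝ 1 h ∧ (∀ t, f t - f a = ((t - a : ℝ) : ℂ) * h t) ∧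
      h a = deriv f a := by
  have hf1 : ContDiff ℝ 1 (deriv f) := (contDiff_succ_iff_deriv (n := 1)).1 hf |>.2.2
  have hd : Differentiable ℝ f := hf.differentiable (by simp)
  have hd1 : Differentiable ℝ (deriv f) := hf1.differentiable (by simp)
  have hc1 : Continuous (deriv f) := hf1.continuous
  have hc2 : Continuous (deriv (deriv f)) := hf1.continuous_deriv (by simp)
  -- The quotient is the mean of `f'` over the segment from `a` to `t`; differentiating it under the
  -- integral uses `f''`, which is where `C²` enters.
  let h : ℝ → ℂ := fun t => ∫ σ in (0 : ℝ)..1, deriv f (a + σ * (t - a))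
  let h' : ℝ → ℂ := fun t => ∫ σ in (0 : ℝ)..1, σ • deriv (deriv f) (a + σ * (t - a))
  have hder : ∀ t, HasDerivAt h (h' t) t := by
    intro t
    obtain ⟨M, hM⟩ := (isCompact_Icc.prod (isCompact_Icc (a := t - 1) (b := t + 1))).exists_bound_of_continuousOn
      (s := Icc (0 : ℝ) 1 ×ˢ Icc (t - 1) (t + 1))
      (f := fun p : ℝ × ℝ => p.1 • deriv (deriv f) (a + p.1 * (p.2 - a)))
      (by fun_prop)
    refine (intervalIntegral.hasDerivAt_integral_of_dominated_loc_of_deriv_le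
      (F := fun t σ => deriv f (a + σ * (t - a)))
      (F' := fun t σ => σ • deriv (deriv f) (a + σ * (t - a)))
      (s := Icc (t - 1) (t + 1)) (bound := fun _ => M) (Icc_mem_nhds (by linarith) (by linarith))
      (Eventually.of_forall fun x => ?_) ?_ ?_ ?_ ?_ ?_).2
    · exact (by fun_prop : Continuous _).aestronglyMeasurable
    · exact (by fun_prop : Continuous _).intervalIntegrable _ _
    · exact (by fun_prop : Continuous _).aestronglyMeasurable
    · refine Eventually.of_forall fun σ hσ x hx => ?_
      rw [uIoc_of_le zero_le_one] at hσ
      exact hM (σ, x) ⟨⟨hσ.1.le, hσ.2⟩, hx⟩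
    · exact intervalIntegrable_const
    · refine Eventually.of_forall fun σ _ x _ => ?_
      have h1 : HasDerivAt (fun x : ℝ => a + σ * (x - a)) σ x := by
        simpa using (((hasDerivAt_id x).sub_const a).const_mul σ).const_add a
      exact (hd1 _).hasDerivAt.scomp x h1
  refine ⟨h, ?_, ?_, by simp [h]⟩
  · rw [contDiff_one_iff_deriv]
    refine ⟨fun t => (hder t).differentiableAt, ?_⟩
    rw [show deriv h = h' from funext fun t => (hder t).deriv]
    exact intervalIntegral.continuous_parametric_intervalIntegral_of_continuous' (by fun_prop) _ _
  · intro t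
    have : ∀ σ ∈ uIcc (0 : ℝ) 1, HasDerivAt (fun σ : ℝ => f (a + σ * (t - a)))
        ((t - a) • deriv f (a + σ * (t - a))) σ := by
      intro σ _
      have h1 : HasDerivAt (fun σ : ℝ => a + σ * (t - a)) (t - a) σ := by
        simpa using ((hasDerivAt_id σ).mul_const (t - a)).const_add a
      exact (hd _).hasDerivAt.scomp σ h1
    have h2 := intervalIntegral.integral_eq_sub_of_hasDerivAt this
      ((by fun_prop : Continuous _).intervalIntegrable _ _)
    rw [intervalIntegral.integral_smul] at h2
    simp only [one_mul, zero_mul, add_zero, add_sub_cancel] at h2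
    rw [← h2]; simp [h]

theorem sin_pi_mul_sub_eq_zero_iff {t a : ℝ} (h : |t - a| < 1) :
    Real.sin (Real.pi * (t - a)) = 0 ↔ t = a := by
  constructor
  · intro h0
    rw [Real.sin_eq_zero_iff] at h0
    obtain ⟨n, hn⟩ := h0
    have h1 : (n : ℝ) = t - a := by
      have := Real.pi_pos
      field_simp at hn
      linarith
    rw [← h1] at h
    have : n = 0 := by
      have : |n| < 1 := by exact_mod_cast h
      simpa using this
    subst this
    push_cast at h1
    linarith
  · rintro rfl; simp

theorem eq_add_int_of_sin_eq_zero {t a : ℝ} (h : Real.sin (Real.pi * (t - a)) = 0) :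
    ∃ n : ℤ, t = a + n := by
  rw [Real.sin_eq_zero_iff] at h
  obtain ⟨n, hn⟩ := h
  refine ⟨n, ?_⟩
  have := Real.pi_pos
  field_simp at hn
  linarith

/-- For a regular simple closed curve of period `1`, the chord from `γ a` divided by
`sin (π (t - a))` extends to a nowhere vanishing antiperiodic `C¹` curve. -/
theorem exists_chord_factor {γ : ℝ → ℂ} (hγ : ContDiff ℝ 2 γ) (hper : Function.Periodic γ 1)
    (hinj : InjOn γ (Ico 0 1)) {a : ℝ} (hreg : deriv γ a ≠ 0) :
    ∃ Q : ℝ → ℂ, ContDiff ℝ 1 Q ∧ (∀ t, Q (t + 1) = - Q t) ∧ (∀ t, Q t ≠ 0) ∧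
      (∀ t, γ t - γ a = (Real.sin (Real.pi * (t - a)) : ℂ) * Q t) ∧
      Q a = deriv γ a / Real.pi := by
  classical
  obtain ⟨h, hh, hhf, hha⟩ := exists_contDiff_one_sub_eq_mul hγ a
  obtain ⟨s, hs, hsf, hsa⟩ := exists_contDiff_one_sub_eq_mul
    (f := fun t : ℝ => ((Real.sin (Real.pi * (t - a)) : ℝ) : ℂ))
    (Complex.ofRealCLM.contDiff.comp
      (Real.contDiff_sin.comp (contDiff_const.mul (contDiff_id.sub contDiff_const)))) a
  have hsa' : s a = Real.pi := by
    rw [hsa]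
    have h1 : HasDerivAt (fun t : ℝ => Real.pi * (t - a)) Real.pi a := by
      simpa using ((hasDerivAt_id a).sub_const a).const_mul Real.pi
    have := (h1.sin).ofReal_comp
    simpa using this.deriv
  simp only [sub_self, mul_zero, Real.sin_zero, Complex.ofReal_zero, sub_zero] at hsf
  -- At the zeros `a + n` of the sine the value is the limit `γ'(a)/π`, with the sign `cos (π n) =
  -- (-1)^n` that antiperiodicity demands.
  let Q : ℝ → ℂ := fun t => if Real.sin (Real.pi * (t - a)) = 0
    then (Real.cos (Real.pi * (t - a)) : ℂ) * (deriv γ a / Real.pi)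
    else (γ t - γ a) / (Real.sin (Real.pi * (t - a)) : ℂ)
  have hsh : ∀ t, Real.pi * (t + 1 - a) = Real.pi * (t - a) + Real.pi := fun t => by ring
  have hanti : ∀ t, Q (t + 1) = - Q t := by
    intro t
    simp only [Q, hsh, Real.sin_add_pi, Real.cos_add_pi, hper t, neg_eq_zero]
    split_ifs
    · push_cast; ring
    · push_cast; rw [div_neg]
  have hpi : (Real.pi : ℂ) ≠ 0 := by exact_mod_cast Real.pi_ne_zero
  -- On this window the sine vanishes only at `a`, so dividing both Hadamard factorizations cancels
  -- the common factor `t - a`. Antiperiodicity then carries the smoothness to all `t`.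
  have hloc : ∀ t, |t - a| < 1 → s t ≠ 0 ∧ Q t = h t / s t := by
    intro t ht
    rcases eq_or_ne t a with rfl | hne
    · refine ⟨by rw [hsa']; exact hpi, ?_⟩
      simp [Q, hsa', hha]
    · have h0 : Real.sin (Real.pi * (t - a)) ≠ 0 := fun h0 =>
        hne ((sin_pi_mul_sub_eq_zero_iff ht).1 h0)
      have hst : s t ≠ 0 := by
        intro h1
        have := hsf t
        rw [h1, mul_zero] at this
        exact h0 (by exact_mod_cast this)
      have hta : ((t - a : ℝ) : ℂ) ≠ 0 := by exact_mod_cast sub_ne_zero.2 hne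
      refine ⟨hst, ?_⟩
      simp only [Q, if_neg h0]
      rw [hsf, hhf, mul_div_mul_left _ _ hta]
  have hC : ∀ t, |t - a| < 1 → ContDiffAt ℝ 1 Q t := by
    intro t ht
    have hev : ∀ᶠ x in 𝓝 t, |x - a| < 1 :=
      (continuous_abs.comp (continuous_sub_right a)).continuousAt.eventually_lt continuousAt_const ht
    exact (hh.contDiffAt.mul (hs.contDiffAt.inv (hloc t ht).1)).congr_of_eventuallyEq
      (hev.mono fun x hx => by rw [(hloc x hx).2, div_eq_mul_inv]; rfl)
  have hshift : ∀ t, ContDiffAt ℝ 1 Q t ↔ ContDiffAt ℝ 1 Q (t + 1) := by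
    intro t
    constructor
    · intro h
      have h1 : Q = fun x => - Q (x - 1) := by
        funext x; rw [← hanti, sub_add_cancel]
      rw [h1]
      refine ContDiffAt.neg ?_
      have : ContDiffAt ℝ 1 Q ((t + 1) - 1) := by simpa using h
      exact this.comp (t + 1) (contDiffAt_id.sub contDiffAt_const)
    · intro h
      have h1 : Q = fun x => - Q (x + 1) := by
        funext x; rw [hanti, neg_neg]
      rw [h1]
      exact (h.comp t (contDiffAt_id.add contDiffAt_const)).neg
  have hshiftn : ∀ (n : ℕ) t, ContDiffAt ℝ 1 Q t ↔ ContDiffAt ℝ 1 Q (t + n) := by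
    intro n
    induction n with
    | zero => intro t; simp
    | succ k ih =>
      intro t
      rw [ih t, hshift (t + k)]
      push_cast
      rw [add_assoc]
  have hCall : ∀ t, ContDiffAt ℝ 1 Q t := by
    intro t
    obtain ⟨n, hn⟩ : ∃ n : ℤ, |t - n - a| < 1 :=
      ⟨round (t - a), by
        have := abs_sub_round (t - a)
        rw [show t - round (t - a) - a = t - a - round (t - a) by ring]
        linarith⟩
    have h1 := hC _ hn
    rcases n.eq_nat_or_neg with ⟨k, rfl | rfl⟩
    · have := (hshiftn k _).1 h1
      simpa using this
    · rw [hshiftn k]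
      simpa using h1
  have hfac : ∀ t, γ t - γ a = (Real.sin (Real.pi * (t - a)) : ℂ) * Q t := by
    intro t
    by_cases h0 : Real.sin (Real.pi * (t - a)) = 0
    · obtain ⟨n, rfl⟩ := eq_add_int_of_sin_eq_zero h0
      rw [h0]
      have := (hper.int_mul n) a
      simp only [mul_one] at this
      simp [this]
    · have : (Real.sin (Real.pi * (t - a)) : ℂ) ≠ 0 := by exact_mod_cast h0
      simp only [Q, if_neg h0]
      rw [mul_div_cancel₀ _ this]
  refine ⟨Q, contDiff_iff_contDiffAt.2 hCall, hanti, ?_, hfac, by simp [Q]⟩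
  intro t h0
  by_cases hs0 : Real.sin (Real.pi * (t - a)) = 0
  · simp only [Q, if_pos hs0] at h0
    have hc : Real.cos (Real.pi * (t - a)) ≠ 0 := by
      intro hc
      have := Real.sin_sq_add_cos_sq (Real.pi * (t - a))
      rw [hs0, hc] at this
      norm_num at this
    have hc' : (Real.cos (Real.pi * (t - a)) : ℂ) ≠ 0 := by exact_mod_cast hc
    exact (mul_ne_zero hc' (div_ne_zero hreg hpi)) h0
  · have h1 := hfac t
    rw [h0, mul_zero, sub_eq_zero] at h1
    have h2 : γ (Int.fract t) = γ (Int.fract a) := by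
      have e1 := (hper.sub_int_mul_eq ⌊t⌋ : γ (t - ⌊t⌋ * 1) = γ t)
      have e2 := (hper.sub_int_mul_eq ⌊a⌋ : γ (a - ⌊a⌋ * 1) = γ a)
      simp only [mul_one] at e1 e2
      rw [Int.fract, Int.fract, e1, e2, h1]
    have h3 := hinj ⟨Int.fract_nonneg t, Int.fract_lt_one t⟩
      ⟨Int.fract_nonneg a, Int.fract_lt_one a⟩ h2
    apply hs0
    rw [Real.sin_eq_zero_iff]
    rw [Int.fract_eq_fract] at h3
    obtain ⟨n, hn⟩ := h3
    exact ⟨n, by rw [hn]; ring⟩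

/-- A nowhere vanishing `C¹` curve has a `C¹` logarithm. -/
theorem exists_contDiff_log {f : ℝ → ℂ} (hf : ContDiff ℝ 1 f) (h0 : ∀ t, f t ≠ 0) :
    ∃ L : ℝ → ℂ, ContDiff ℝ 1 L ∧ ∀ t, Complex.exp (L t) = f t := by
  have hd : Differentiable ℝ f := hf.differentiable (by simp)
  have hc : Continuous (deriv f) := hf.continuous_deriv (by simp)
  have hq : Continuous fun t => deriv f t / f t := hc.div hf.continuous h0
  let L : ℝ → ℂ := fun t => Complex.log (f 0) + ∫ x in (0 : ℝ)..t, deriv f x / f x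
  have hL : ∀ t, HasDerivAt L (deriv f t / f t) t := fun t =>
    (intervalIntegral.integral_hasDerivAt_right (hq.intervalIntegrable _ _)
      (hq.stronglyMeasurableAtFilter _ _) hq.continuousAt).const_add _
  refine ⟨L, ?_, ?_⟩
  · rw [contDiff_one_iff_deriv]
    refine ⟨fun t => (hL t).differentiableAt, ?_⟩
    rwa [show deriv L = fun t => deriv f t / f t from funext fun t => (hL t).deriv]
  · have hder : ∀ t, HasDerivAt (fun t => f t * Complex.exp (- L t)) 0 t := by
      intro t
      refine ((hd t).hasDerivAt.mul (hL t).neg.cexp).congr_deriv ?_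
      have := h0 t
      field_simp
      ring
    have hconst := is_const_of_deriv_eq_zero (fun t => (hder t).differentiableAt)
      (fun t => (hder t).deriv)
    intro t
    have h1 := hconst t 0
    have h2 : L 0 = Complex.log (f 0) := by simp [L]
    simp only [h2, Complex.exp_neg, Complex.exp_log (h0 0), mul_inv_cancel₀ (h0 0)] at h1
    exact (eq_of_mul_inv_eq_one h1).symm

/-- Two continuous phases of the same function which agree at a point agree. -/
theorem phase_eqOn {s : Set ℝ} (hs : IsPreconnected s) {A B : ℝ → ℝ} (hA : ContinuousOn A s)
    (hB : ContinuousOn B s)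
    (h : ∀ t ∈ s, Complex.exp (A t * Complex.I) = Complex.exp (B t * Complex.I))
    {a : ℝ} (ha : a ∈ s) (hab : A a = B a) : EqOn A B s :=
  Circle.isCoveringMap_exp.eqOn_of_comp_eqOn hs hA hB
    (fun t ht => Circle.ext (by simpa [Circle.coe_exp] using h t ht)) ha hab

/-- Hopf's observation: for a closed curve which lies in the closed half plane
`{z | 0 ≤ ⟪z - γ a, e⟫}` and leaves `γ a` in direction `-i e`, the argument of the chord from `γ a`
increases by `π` over one period. -/
theorem chord_phase_add_one {γ Q : ℝ → ℂ} {a c : ℝ} {e : ℂ} (hQc : Continuous Q)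
    (hanti : ∀ t, Q (t + 1) = - Q t) (hQ0 : ∀ t, Q t ≠ 0)
    (hfac : ∀ t, γ t - γ a = (Real.sin (Real.pi * (t - a)) : ℂ) * Q t)
    (hhalf : ∀ t, 0 ≤ inner ℝ e (γ t - γ a)) (hc : 0 < c) (he : e ≠ 0)
    (hQa : Q a = c * (-Complex.I * e)) {A : ℝ → ℝ} (hA : Continuous A)
    (hAQ : ∀ t, Q t = ‖Q t‖ * Complex.exp (A t * Complex.I)) (t : ℝ) :
    A (t + 1) = A t + Real.pi := by
  have hu : (-Complex.I * e) ≠ 0 := mul_ne_zero (by simp) he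
  let W : ℝ → ℂ := fun t => Q t / (-Complex.I * e)
  have hWc : Continuous W := hQc.div_const _
  have hW0 : ∀ t, W t ≠ 0 := fun t => div_ne_zero (hQ0 t) hu
  have hWa : W a = c := by simp only [W, hQa]; field_simp
  have hWa1 : W (a + 1) = -c := by simp only [W, hanti, hQa]; field_simp
  have hWim : ∀ t, (W t).im = inner ℝ e (Q t) / ‖e‖ ^ 2 := by
    intro t
    simp only [W, Complex.inner, Complex.div_im, Complex.mul_re, Complex.mul_im, Complex.neg_re,
      Complex.neg_im, Complex.I_re, Complex.I_im, Complex.conj_re, Complex.conj_im,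
      Complex.sq_norm, Complex.normSq_apply]
    have : e.re * e.re + e.im * e.im ≠ 0 := by
      rw [← Complex.normSq_apply]; simpa using he
    have h2 : (-0 * e.re - -1 * e.im) * (-0 * e.re - -1 * e.im) +
      (-0 * e.im + -1 * e.re) * (-0 * e.im + -1 * e.re) = e.re * e.re + e.im * e.im := by ring
    rw [h2]
    field_simp
    ring
  -- Strictly inside the period the sine is positive, so `Q t` points to the same side of the
  -- supporting line as the chord.
  have hWnn : ∀ t ∈ Icc a (a + 1), 0 ≤ (W t).im := by
    intro t ht
    rcases eq_or_lt_of_le ht.1 with rfl | h1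
    · rw [hWa]; simp
    rcases eq_or_lt_of_le ht.2 with rfl | h2
    · rw [hWa1]; simp
    rw [hWim]
    refine div_nonneg ?_ (by positivity)
    have hs : 0 < Real.sin (Real.pi * (t - a)) :=
      Real.sin_pos_of_pos_of_lt_pi (mul_pos Real.pi_pos (by linarith))
        (by nlinarith [Real.pi_pos])
    have h3 := hhalf t
    rw [hfac, ← Complex.real_smul, inner_smul_right] at h3
    exact nonneg_of_mul_nonneg_right h3 hs
  -- The principal argument jumps across the negative axis only when approached from below, so it is
  -- continuous on the closed upper half plane without `0`. Over the period it goes from `arg c = 0`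
  -- to `arg (-c) = π`.
  have harg : ContinuousOn (fun t => Complex.arg (W t)) (Icc a (a + 1)) := by
    intro t ht
    have h1 : ContinuousWithinAt Complex.arg {z | 0 ≤ z.im} (W t) := by
      by_cases hsl : W t ∈ Complex.slitPlane
      · exact (Complex.continuousAt_arg hsl).continuousWithinAt
      · rw [Complex.mem_slitPlane_iff] at hsl
        push Not at hsl
        refine Complex.continuousWithinAt_arg_of_re_neg_of_im_zero
          (lt_of_le_of_ne hsl.1 fun h => hW0 t (Complex.ext h hsl.2)) hsl.2
    exact h1.comp hWc.continuousWithinAt hWnn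
  have key : A (a + 1) = A a + Real.pi := by
    have h1 := phase_eqOn (B := fun t => A a + Complex.arg (W t)) isPreconnected_Icc
      hA.continuousOn (continuousOn_const.add harg) (a := a) ?_ (left_mem_Icc.2 (by linarith)) ?_
      (right_mem_Icc.2 (by linarith : a ≤ a + 1))
    · rw [h1]
      simp only [hWa1]
      rw [← Complex.ofReal_neg, Complex.arg_ofReal_of_neg (by linarith)]
    · intro t _
      have e1 : ∀ t, Complex.exp (A t * Complex.I) = Q t / ‖Q t‖ := fun t => by
        have : (‖Q t‖ : ℂ) ≠ 0 := by simpa using hQ0 t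
        rw [eq_div_iff this, mul_comm]; exact (hAQ t).symm
      have e2 : Complex.exp (Complex.arg (W t) * Complex.I) = W t / ‖W t‖ := by
        have : (‖W t‖ : ℂ) ≠ 0 := by simpa using hW0 t
        rw [eq_div_iff this, mul_comm]; exact Complex.norm_mul_exp_arg_mul_I _
      have h3 : (‖Q t‖ : ℂ) ≠ 0 := by simpa using hQ0 t
      have h4 : (‖e‖ : ℂ) ≠ 0 := by simpa using he
      have h5 : (c : ℂ) ≠ 0 := by exact_mod_cast hc.ne'
      push_cast
      rw [add_mul, Complex.exp_add, e1, e1, e2, hQa]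
      simp only [W, norm_mul, norm_div, norm_neg, Complex.norm_I, one_mul, Complex.norm_real,
        Real.norm_eq_abs, abs_of_pos hc]
      push_cast
      field_simp
    · simp [hWa, Complex.arg_ofReal_of_nonneg hc.le]
  -- Both sides are phases of `-Q t` and agree at `a`, hence everywhere.
  have h2 := phase_eqOn (A := fun t => A (t + 1)) (B := fun t => A t + Real.pi) isPreconnected_univ
    (by fun_prop) (by fun_prop) (a := a) ?_ (mem_univ a) key (mem_univ t)
  · exact h2
  · intro t _
    have h3 : (‖Q t‖ : ℂ) ≠ 0 := by simpa using hQ0 t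
    have h1 := hAQ (t + 1)
    rw [hanti, norm_neg, hAQ t] at h1
    push_cast
    rw [add_mul, Complex.exp_add, Complex.exp_pi_mul_I]
    have h4 : ‖((‖Q t‖ : ℂ)) * Complex.exp (A t * Complex.I)‖ = ‖Q t‖ := by rw [← hAQ t]
    rw [h4] at h1
    apply mul_left_cancel₀ h3
    rw [← h1]; ring

theorem eq_add_int_of_injOn {γ : ℝ → ℂ} (hper : Function.Periodic γ 1)
    (hinj : InjOn γ (Ico 0 1)) {s t : ℝ} (h : γ s = γ t) : ∃ n : ℤ, s = t + n := by
  have e1 := (hper.sub_int_mul_eq ⌊s⌋ : γ (s - ⌊s⌋ * 1) = γ s)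
  have e2 := (hper.sub_int_mul_eq ⌊t⌋ : γ (t - ⌊t⌋ * 1) = γ t)
  simp only [mul_one] at e1 e2
  have h3 := hinj ⟨Int.fract_nonneg s, Int.fract_lt_one s⟩
    ⟨Int.fract_nonneg t, Int.fract_lt_one t⟩ (by rw [Int.fract, Int.fract, e1, e2, h])
  rw [Int.fract_eq_fract] at h3
  obtain ⟨n, hn⟩ := h3
  exact ⟨n, by linarith⟩

/-! ### Extension of functions from the curve to the plane -/

/-- Near a point `γ a` of a simple closed curve, all the points of the curve have parameters
near `a`. -/
theorem eventually_exists_param_near {γ : ℝ → ℂ} (hγ : Continuous γ)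
    (hper : Function.Periodic γ 1) (hinj : InjOn γ (Ico 0 1)) (a : ℝ) {V : Set ℝ}
    (hV : V ∈ 𝓝 a) : ∀ᶠ z in 𝓝 (γ a), ∀ t, γ t = z → ∃ s ∈ V, γ s = γ t ∧ ∃ n : ℤ, s = t + n := by
  obtain ⟨r, hr, hrV⟩ := Metric.mem_nhds_iff.1 hV
  -- A full period without a neighbourhood of `a`: its image is compact and misses `γ a` by
  -- injectivity, so points close to `γ a` have no parameter in it.
  let K : Set ℝ := Icc (a - 1 / 2) (a + 1 / 2) \ Metric.ball a (min r (1 / 2))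
  have hK : IsCompact K := isCompact_Icc.diff Metric.isOpen_ball
  have hp : γ a ∉ γ '' K := by
    rintro ⟨s, ⟨hs, hs'⟩, hsa⟩
    obtain ⟨n, hn⟩ := eq_add_int_of_injOn hper hinj hsa
    have h0 : n = 0 := by
      have h1 : (n : ℝ) < 1 := by linarith [hs.2]
      have h2 : (-1 : ℝ) < n := by linarith [hs.1]
      have h1' : n < 1 := by exact_mod_cast h1
      have h2' : -1 < n := by exact_mod_cast h2
      omega
    subst h0
    apply hs'
    rw [hn]
    simp [hr]
  filter_upwards [(hK.image hγ).isClosed.isOpen_compl.mem_nhds hp] with z hz t htz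
  have hrd := abs_sub_round (t - a)
  rw [abs_le] at hrd
  have hγs : γ (t - round (t - a)) = γ t := by
    have := hper.sub_int_mul_eq (round (t - a)) (x := t)
    simpa using this
  refine ⟨t - round (t - a), ?_, hγs, -round (t - a), by push_cast; ring⟩
  by_contra hns
  refine hz ⟨t - round (t - a), ⟨⟨by linarith, by linarith⟩, fun hb => hns (hrV ?_)⟩, hγs.trans htz⟩
  exact Metric.ball_subset_ball (min_le_left _ _) hb

open scoped Manifold in
/-- A periodic `C¹` function of the parameter of a regular simple closed curve is the restriction
of a `C¹` function on the plane. -/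
theorem exists_contDiff_extension {γ : ℝ → ℂ} (hγ : ContDiff ℝ 1 γ)
    (hper : Function.Periodic γ 1) (hinj : InjOn γ (Ico 0 1)) (hreg : ∀ t, deriv γ t ≠ 0)
    {Ψ : ℝ → ℝ} (hΨ : ContDiff ℝ 1 Ψ) (hΨp : Function.Periodic Ψ 1) :
    ∃ ψ : ℂ → ℝ, ContDiff ℝ 1 ψ ∧ ∀ t, ψ (γ t) = Ψ t := by
  have hΨn : ∀ (t : ℝ) (n : ℤ), Ψ (t + n) = Ψ t := fun t n => by
    have := hΨp.int_mul n t
    simpa using this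
  -- The admissible values at `z`: forced on the curve, arbitrary off it. Each such set is convex,
  -- so a partition of unity glues local extensions.
  let T : ℂ → Set ℝ := fun z => {y | ∀ t, γ t = z → y = Ψ t}
  have hT : ∀ z, Convex ℝ (T z) := by
    intro z y₁ h₁ y₂ h₂ a b _ _ hab t ht
    rw [h₁ t ht, h₂ t ht, ← add_smul, hab, one_smul]
  have hloc : ∀ z : ℂ, ∃ U ∈ 𝓝 z, ∃ f : ℂ → ℝ, ContMDiffOn 𝓘(ℝ, ℂ) 𝓘(ℝ, ℝ) 1 f U ∧
      ∀ y ∈ U, f y ∈ T y := by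
    intro z
    by_cases hz : z ∈ range γ
    · obtain ⟨a, rfl⟩ := hz
      -- Projecting onto the tangent at `γ a` makes `t ↦ ℓ (γ t)` a local diffeomorphism; its
      -- inverse recovers the parameter, so `Ψ ∘ e.symm ∘ ℓ` extends `Ψ` locally.
      let ℓ : ℂ →L[ℝ] ℝ := innerSL ℝ (deriv γ a)
      have hℓγ : ContDiff ℝ 1 fun t => ℓ (γ t) := ℓ.contDiff.comp hγ
      have hder : HasDerivAt (fun t => ℓ (γ t)) (ℓ (deriv γ a)) a :=
        ℓ.hasFDerivAt.comp_hasDerivAt a ((hγ.differentiable (by simp)) a).hasDerivAt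
      have hne : ℓ (deriv γ a) ≠ 0 := by
        simp only [ℓ, innerSL_apply_apply, real_inner_self_eq_norm_sq]
        exact pow_ne_zero _ (norm_ne_zero_iff.2 (hreg a))
      have hder' : HasFDerivAt (fun t => ℓ (γ t))
          (ContinuousLinearEquiv.unitsEquivAut ℝ (Units.mk0 _ hne) : ℝ →L[ℝ] ℝ) a := by
        refine hder.hasFDerivAt.congr_fderiv ?_
        ext; simp
      let e := hℓγ.contDiffAt.toOpenPartialHomeomorph _ hder' (by simp)
      have hae : a ∈ e.source := hℓγ.contDiffAt.mem_toOpenPartialHomeomorph_source hder' (by simp)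
      have hinv : ContDiffAt ℝ 1 e.symm (ℓ (γ a)) :=
        hℓγ.contDiffAt.to_localInverse hder' (by simp)
      have hf : ContDiffAt ℝ 1 (fun z => Ψ (e.symm (ℓ z))) (γ a) :=
        hΨ.contDiffAt.comp _ (hinv.comp (γ a) ℓ.contDiff.contDiffAt)
      obtain ⟨U, hU, hfU⟩ := hf.contDiffOn le_rfl (by simp)
      refine ⟨_, inter_mem hU (eventually_exists_param_near hγ.continuous hper hinj a
        (e.open_source.mem_nhds hae)), _, (hfU.mono inter_subset_left).contMDiffOn, ?_⟩
      rintro y ⟨_, hy⟩ t ht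
      obtain ⟨s, hs, hst, n, hn⟩ := hy t ht
      have h1 : e.symm (ℓ (γ s)) = s := e.left_inv hs
      rw [← ht, ← hst, h1, hn, hΨn]
    · have hcl : IsClosed (range γ) := by
        have : range γ = γ '' Icc 0 1 := by
          have := hper.image_Icc one_pos 0
          rw [zero_add] at this
          exact this.symm
        rw [this]
        exact (isCompact_Icc.image hγ.continuous).isClosed
      exact ⟨_, hcl.isOpen_compl.mem_nhds hz, fun _ => 0, contMDiffOn_const,
        fun y hy t ht => (hy ⟨t, ht⟩).elim⟩
  obtain ⟨ψ, hψ⟩ := exists_contMDiffMap_forall_mem_convex_of_local (n := 1) 𝓘(ℝ, ℂ) hT hloc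
  exact ⟨ψ, ψ.contMDiff.contDiff, fun t => hψ (γ t) t rfl⟩

/-! ### Supporting points and factorization of the boundary map -/

/-- Boundary points `γ (param j)` at which `Ω` lies in the half plane with inner normal `dir j`,
together with a factorization of `g` along the boundary into the unit directions `chordDir j` of
the lines through these points and a single valued phase. -/
structure BoundaryFactorization (Ω : Set ℂ) (g : ℂ → ℂ) (γ : ℝ → ℂ) (n : ℕ) where
  phase : ℂ → ℝ
  param : Fin n → ℝ
  dir : Fin n → ℂ
  chordDir : Fin n → ℝ → ℂ
  contDiff_phase : ContDiff ℝ 1 phase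
  norm_dir : ∀ j, ‖dir j‖ = 1
  inner_nonneg : ∀ j, ∀ z ∈ closure Ω, 0 ≤ inner ℝ (dir j) (z - γ (param j))
  injective : Function.Injective fun j => γ (param j)
  norm_chordDir : ∀ j t, ‖chordDir j t‖ = 1
  chord_eq : ∀ j t, ∃ r : ℝ, γ t - γ (param j) = r * chordDir j t
  chord_lower : ∀ j, ∃ c : ℝ, 0 < c ∧
    ∀ t, |t - param j| ≤ 1 / 2 → c * |t - param j| ≤ ‖γ t - γ (param j)‖
  map_eq : ∀ t, g (γ t) = Complex.exp (phase (γ t) * Complex.I) * ∏ j, chordDir j t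

theorem inner_eq_re_im (z w : ℂ) : inner ℝ z w = z.re * w.re + z.im * w.im := by
  simp [Complex.inner]; ring

/-- In each direction there is a boundary point at which `Ω` lies in a half plane. -/
theorem exists_extremal_param {α : ℝ≥0} {Ω : Set ℂ} (hΩ_open : IsOpen Ω)
    (hΩ_bdd : Bornology.IsBounded Ω) {γ : ℝ → ℂ} (hγ : IsPositiveBoundaryParam α Ω γ) {e : ℂ}
    (he : ‖e‖ = 1) :
    ∃ a ∈ Ico (0 : ℝ) 1, (∀ z ∈ closure Ω, 0 ≤ inner ℝ e (z - γ a)) ∧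
      ∃ c : ℝ, 0 < c ∧ deriv γ a = c * (-Complex.I * e) := by
  have hne : (closure Ω).Nonempty := by
    obtain ⟨r, hr⟩ := (hγ.inward 0).exists
    exact ⟨_, subset_closure hr⟩
  obtain ⟨m, hm, hmin⟩ := hΩ_bdd.isCompact_closure.exists_isMinOn hne
    (f := fun z => inner ℝ e z) (by fun_prop)
  have he2 : e.re * e.re + e.im * e.im = 1 := by
    rw [← Complex.normSq_apply, Complex.normSq_eq_norm_sq, he, one_pow]
  have hmΩ : m ∉ Ω := by
    intro hmΩ
    have hcont : ContinuousAt (fun r : ℝ => m - r * e) 0 := by fun_prop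
    have hev : ∀ᶠ r : ℝ in 𝓝[>] 0, m - r * e ∈ Ω :=
      (hcont.eventually (hΩ_open.mem_nhds (by simpa using hmΩ))).filter_mono nhdsWithin_le_nhds
    obtain ⟨r, hr, hr0⟩ := (hev.and self_mem_nhdsWithin).exists
    have h1 : inner ℝ e m ≤ inner ℝ e (m - r * e) := hmin (subset_closure hr)
    rw [inner_sub_right, ← Complex.real_smul, inner_smul_right, real_inner_self_eq_norm_sq, he]
      at h1
    have : 0 < r := hr0
    linarith
  have hmf : m ∈ range γ := by
    rw [hγ.range_eq, frontier, hΩ_open.interior_eq]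
    exact ⟨hm, hmΩ⟩
  obtain ⟨t, rfl⟩ := hmf
  have hfr : γ (Int.fract t) = γ t := by
    have := hγ.periodic.sub_int_mul_eq ⌊t⌋ (x := t)
    rwa [mul_one] at this
  have hhalf : ∀ z ∈ closure Ω, 0 ≤ inner ℝ e (z - γ (Int.fract t)) := by
    intro z hz
    rw [hfr, inner_sub_right, sub_nonneg]
    exact hmin hz
  refine ⟨Int.fract t, ⟨Int.fract_nonneg t, Int.fract_lt_one t⟩, hhalf, ?_⟩
  set a := Int.fract t
  have hγcl : ∀ s, γ s ∈ closure Ω := fun s =>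
    frontier_subset_closure (hγ.range_eq ▸ mem_range_self s)
  have hda : HasDerivAt γ (deriv γ a) a :=
    (hγ.smooth.1.differentiable (by simp) a).hasDerivAt
  have hd : HasDerivAt (fun s => inner ℝ e (γ s)) (inner ℝ e (deriv γ a)) a :=
    (innerSL ℝ e).hasFDerivAt.comp_hasDerivAt a hda
  have hlm : IsLocalMin (fun s => inner ℝ e (γ s)) a := Eventually.of_forall fun s => by
    have := hhalf _ (hγcl s)
    rwa [inner_sub_right, sub_nonneg] at this
  have h0 : inner ℝ e (deriv γ a) = 0 := hlm.hasDerivAt_eq_zero hd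
  have h1 : 0 ≤ inner ℝ e (Complex.I * deriv γ a) := by
    obtain ⟨r, hr, hr0⟩ := ((hγ.inward a).and self_mem_nhdsWithin).exists
    have := hhalf _ (subset_closure hr)
    rw [add_sub_cancel_left, ← Complex.real_smul, inner_smul_right] at this
    exact nonneg_of_mul_nonneg_right this hr0
  -- The tangent has no component along `e`, so it equals its component along `-i e`. That component
  -- is `⟪e, i d⟫`, which is nonnegative because `i d` points into `Ω`.
  set d := deriv γ a with hd_def
  have heq : d = (inner ℝ e (Complex.I * d) : ℝ) * (-Complex.I * e) := by
    rw [inner_eq_re_im] at h0 ⊢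
    apply Complex.ext
    · simp
      linear_combination (-d.re) * he2 + e.re * h0
    · simp
      linear_combination (-d.im) * he2 + e.im * h0
  refine ⟨_, lt_of_le_of_ne h1 fun h => hγ.regular a ?_, heq⟩
  rw [← hd_def, heq, ← h]; simp

theorem exp_im_mul_I (z : ℂ) :
    Complex.exp (z.im * Complex.I) = Complex.exp z / ‖Complex.exp z‖ := by
  rw [Complex.norm_exp, eq_div_iff (by exact_mod_cast (Real.exp_pos _).ne'), Complex.ofReal_exp,
    ← Complex.exp_add, add_comm, Complex.re_add_im]

/-- Each chord phase grows by `π` per period, so `2D` of them absorb the whole increase `2πD` of the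
phase of `g`; the remaining phase is periodic and extends to the plane. -/
theorem exists_boundaryFactorization {α : ℝ≥0} {Ω : Set ℂ} (hΩ_open : IsOpen Ω)
    (hΩ_bdd : Bornology.IsBounded Ω) {g : ℂ → ℂ} (hg : IsC3HolderCircleMap α (frontier Ω) g)
    {γ : ℝ → ℂ} (hγ : IsPositiveBoundaryParam α Ω γ) {θ : ℝ → ℝ} (hθ : Continuous θ)
    (hgθ : ∀ t, g (γ t) = Complex.exp (θ t * Complex.I)) {D : ℕ}
    (hD : θ 1 - θ 0 = 2 * Real.pi * D) :
    Nonempty (BoundaryFactorization Ω g γ (2 * D)) := by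
  have hγ2 : ContDiff ℝ 2 γ := hγ.smooth.1.of_le (by norm_num)
  have hγ1 : ContDiff ℝ 1 γ := hγ.smooth.1.of_le (by norm_num)
  -- Any pairwise non-parallel directions would do. The tangent at the `j`-th point is a positive
  -- multiple of `-i e j`, so distinct directions give distinct points.
  let w : ℕ → ℂ := fun j => 1 + j * Complex.I
  have hw : ∀ j, w j ≠ 0 := fun j h => by simpa [w] using congrArg Complex.re h
  let e : Fin (2 * D) → ℂ := fun j => w j / ‖w j‖
  have he : ∀ j, ‖e j‖ = 1 := fun j => by simp [e, hw]
  choose a ha hhalf c hc hda using fun j => exists_extremal_param hΩ_open hΩ_bdd hγ (he j)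
  have hinj : Function.Injective fun j => γ (a j) := by
    intro j k hjk
    have h1 : a j = a k := hγ.injOn (ha j) (ha k) hjk
    have h2 : (c j : ℂ) * (-Complex.I * e j) = c k * (-Complex.I * e k) := by
      rw [← hda, ← hda, h1]
    have h3 : ((c j / ‖w j‖ : ℝ) : ℂ) * w j = ((c k / ‖w k‖ : ℝ) : ℂ) * w k := by
      have h4 : (-Complex.I) * (c j * e j) = (-Complex.I) * (c k * e k) := by
        linear_combination h2
      have h5 := mul_left_cancel₀ (by simp : -Complex.I ≠ 0) h4
      simp only [e] at h5
      push_cast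
      linear_combination h5
    have hre := congrArg Complex.re h3
    have him := congrArg Complex.im h3
    rw [Complex.re_ofReal_mul, Complex.re_ofReal_mul] at hre
    rw [Complex.im_ofReal_mul, Complex.im_ofReal_mul] at him
    simp only [w, Complex.add_re, Complex.add_im, Complex.one_re, Complex.one_im, Complex.mul_re,
      Complex.mul_im, Complex.natCast_re, Complex.natCast_im, Complex.I_re, Complex.I_im,
      mul_zero, mul_one, sub_zero, add_zero, zero_add] at hre him
    rw [hre] at him
    have hk : c k / ‖w k‖ ≠ 0 := div_ne_zero (hc k).ne' (norm_ne_zero_iff.2 (hw _))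
    have := mul_left_cancel₀ hk him
    exact Fin.ext (by exact_mod_cast this)
  choose Q hQ hQanti hQ0 hQfac hQa using fun j =>
    exists_chord_factor hγ2 hγ.periodic hγ.injOn (hγ.regular (a j))
  choose L hL hLQ using fun j => exists_contDiff_log (hQ j) (hQ0 j)
  have hγcl : ∀ s, γ s ∈ closure Ω := fun s =>
    frontier_subset_closure (hγ.range_eq ▸ mem_range_self s)
  have hA : ∀ j t, (L j (t + 1)).im = (L j t).im + Real.pi := fun j t => by
    refine chord_phase_add_one (e := e j) (c := c j / Real.pi) (hQ j).continuous (hQanti j) (hQ0 j)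
      (hQfac j) (fun t => hhalf j _ (hγcl t)) (div_pos (hc j) Real.pi_pos)
      (norm_ne_zero_iff.1 (by rw [he j]; exact one_ne_zero)) ?_ (A := fun t => (L j t).im)
      (Complex.continuous_im.comp (hL j).continuous) ?_ t
    · rw [hQa, hda]; push_cast; ring
    · intro t
      have : (‖Q j t‖ : ℂ) ≠ 0 := by simpa using hQ0 j t
      rw [exp_im_mul_I, hLQ, mul_div_cancel₀ _ this]
  obtain ⟨G, hG, hGg⟩ := hg.2
  have hgG : ∀ t, g (γ t) = G (γ t) := fun t => (hGg (hγ.range_eq ▸ mem_range_self t)).symm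
  have hP0 : ∀ t, ∏ j, Q j t ≠ 0 := fun t => Finset.prod_ne_zero_iff.2 fun j _ => hQ0 j t
  have hg1 : ∀ t, ‖g (γ t)‖ = 1 := fun t => by rw [hgθ, Complex.norm_exp_ofReal_mul_I]
  -- The smooth extension `G` replaces `g`, so that the quotient by the chord factors is `C¹`.
  let F : ℝ → ℂ := fun t => G (γ t) * (∏ j, Q j t)⁻¹
  have hF : ContDiff ℝ 1 F :=
    ((hG.1.of_le (by norm_num)).comp hγ1).mul ((contDiff_prod fun j _ => hQ j).inv hP0)
  have hF0 : ∀ t, F t ≠ 0 := fun t => mul_ne_zero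
    (by rw [← hgG]; exact norm_ne_zero_iff.1 (by rw [hg1]; exact one_ne_zero)) (inv_ne_zero (hP0 t))
  -- The number of antiperiodic factors is even, so the signs cancel.
  have hFp : ∀ t, F (t + 1) = F t := by
    intro t
    simp only [F, hQanti, hγ.periodic t, Finset.prod_neg]
    simp
  have hgF : ∀ t, g (γ t) = F t * ∏ j, Q j t := fun t => by
    simp only [F]; rw [inv_mul_cancel_right₀ (hP0 t), hgG]
  obtain ⟨M, hM, hMF⟩ := exists_contDiff_log hF hF0
  have hfact : ∀ t, g (γ t) =
      Complex.exp ((M t).im * Complex.I) * ∏ j, Complex.exp ((L j t).im * Complex.I) := by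
    intro t
    simp only [exp_im_mul_I, hMF, hLQ, Finset.prod_div_distrib]
    rw [div_mul_div_comm, ← hgF]
    have : ‖F t‖ * ∏ j, ‖Q j t‖ = 1 := by
      rw [← norm_prod, ← norm_mul, ← hgF, hg1]
    have h2 : (‖F t‖ : ℂ) * ∏ j, (‖Q j t‖ : ℂ) = 1 := by exact_mod_cast this
    rw [h2, div_one]
  have hMc : Continuous fun t => (M t).im := Complex.continuous_im.comp hM.continuous
  have hLc : ∀ j, Continuous fun t => (L j t).im := fun j =>
    Complex.continuous_im.comp (hL j).continuous
  -- Periodicity of `F` alone gives its phase only modulo `2π`; the degree of `g` makes the increase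
  -- exactly zero.
  have hM01 : (M 1).im = (M 0).im := by
    let A : ℝ → ℝ := fun t => (M t).im + ∑ j, (L j t).im
    have hAc : Continuous A := hMc.add (continuous_finsetSum _ fun j _ => hLc j)
    have hexp : ∀ t, Complex.exp (A t * Complex.I) = Complex.exp (θ t * Complex.I) := by
      intro t
      rw [← hgθ, hfact]
      simp only [A]
      push_cast
      rw [add_mul, Complex.exp_add, Finset.sum_mul, Complex.exp_sum]
    have h1 := phase_eqOn (A := θ) (B := fun t => A t + (θ 0 - A 0)) isPreconnected_univ
      hθ.continuousOn (hAc.add continuous_const).continuousOn (a := 0) ?_ (mem_univ _) (by ring)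
      (mem_univ 1)
    · have h2 : A 1 = (M 1).im + (∑ j, (L j 0).im + 2 * D * Real.pi) := by
        have : ∀ j, (L j 1).im = (L j 0).im + Real.pi := fun j => by simpa using hA j 0
        simp only [A, this, Finset.sum_add_distrib]
        simp
      simp only at h1
      have h3 : A 0 = (M 0).im + ∑ j, (L j 0).im := rfl
      linarith
    · intro t _
      push_cast
      rw [add_mul, sub_mul, Complex.exp_add, Complex.exp_sub, hexp, hexp, div_self
        (Complex.exp_ne_zero _), mul_one]
  have hMp : Function.Periodic (fun t => (M t).im) 1 := by
    intro t
    refine phase_eqOn (A := fun t => (M (t + 1)).im) (B := fun t => (M t).im) isPreconnected_univ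
      (hMc.comp (continuous_add_const 1)).continuousOn hMc.continuousOn (a := 0) ?_ (mem_univ _)
      (by simpa using hM01) (mem_univ t)
    intro t _
    rw [exp_im_mul_I, exp_im_mul_I, hMF, hMF, hFp]
  obtain ⟨ψ, hψ, hψM⟩ := exists_contDiff_extension hγ1 hγ.periodic hγ.injOn hγ.regular
    (Complex.imCLM.contDiff.comp hM) hMp
  refine ⟨⟨ψ, a, e, fun j t => Complex.exp ((L j t).im * Complex.I), hψ, he, hhalf, hinj,
    fun j t => Complex.norm_exp_ofReal_mul_I _, ?_, ?_, ?_⟩⟩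
  · intro j t
    refine ⟨Real.sin (Real.pi * (t - a j)) * ‖Q j t‖, ?_⟩
    have : (‖Q j t‖ : ℂ) ≠ 0 := by simpa using hQ0 j t
    rw [hQfac, exp_im_mul_I, hLQ]
    push_cast
    field_simp
  · intro j
    obtain ⟨t₀, -, ht₀⟩ := (isCompact_Icc (a := a j - 1 / 2) (b := a j + 1 / 2)).exists_isMinOn
      ⟨a j, by constructor <;> linarith⟩ (f := fun t => ‖Q j t‖) (hQ j).continuous.norm.continuousOn
    have hpos : 0 < ‖Q j t₀‖ := norm_pos_iff.2 (hQ0 j t₀)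
    refine ⟨2 * ‖Q j t₀‖, by positivity, fun t ht => ?_⟩
    rw [hQfac, norm_mul, Complex.norm_real, Real.norm_eq_abs]
    have h1 : ‖Q j t₀‖ ≤ ‖Q j t‖ := by
      rw [abs_le] at ht
      exact ht₀ ⟨by linarith, by linarith⟩
    -- Jordan's inequality on half a period to each side of `a j`.
    have h2 : 2 * |t - a j| ≤ |Real.sin (Real.pi * (t - a j))| := by
      have h3 := Real.mul_abs_le_abs_sin (x := Real.pi * (t - a j)) (by
        rw [abs_mul, abs_of_pos Real.pi_pos]
        nlinarith [Real.pi_pos])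
      rw [abs_mul, abs_of_pos Real.pi_pos] at h3
      have : 2 / Real.pi * (Real.pi * |t - a j|) = 2 * |t - a j| := by
        field_simp
      linarith
    calc 2 * ‖Q j t₀‖ * |t - a j| = (2 * |t - a j|) * ‖Q j t₀‖ := by ring
      _ ≤ _ := by gcongr
  · intro t
    rw [hfact, hψM]; rfl

/-! ### Radial integrals over discs and half discs -/

theorem integral_ball_radial {f : ℝ → ℝ} (R : ℝ) :
    ∫ z in Metric.ball (0 : ℂ) R, f ‖z‖ = 2 * Real.pi * ∫ r in Ioo 0 R, r * f r := by
  have h1 : ∫ z in Metric.ball (0 : ℂ) R, f ‖z‖ = ∫ z : ℂ, (Iio R).indicator f ‖z‖ := by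
    rw [← integral_indicator measurableSet_ball]
    refine integral_congr_ae (Eventually.of_forall fun z => ?_)
    simp [indicator]
  have h2 : ∫ r in Ioi (0 : ℝ), r * (Iio R).indicator f r = ∫ r in Ioo 0 R, r * f r := by
    rw [← integral_indicator measurableSet_Ioi, ← integral_indicator measurableSet_Ioo]
    refine integral_congr_ae (Eventually.of_forall fun r => ?_)
    by_cases h0 : 0 < r <;> by_cases hR : r < R <;> simp [indicator, h0, hR]
  rw [h1, integral_fun_norm_addHaar]
  simp only [Complex.finrank_real_complex, Nat.add_one_sub_one, pow_one, smul_eq_mul, h2,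
    measureReal_def, Complex.volume_ball]
  simp
  ring

theorem lintegral_ball_radial {f : ℝ → ℝ} (hf : ∀ r, 0 ≤ f r) {R : ℝ}
    (hint : IntegrableOn (fun r => r * f r) (Ioo 0 R)) (p : ℂ) :
    ∫⁻ z in Metric.ball p R, ENNReal.ofReal (f ‖z - p‖) =
      ENNReal.ofReal (2 * Real.pi * ∫ r in Ioo 0 R, r * f r) := by
  have h0 : ∫⁻ z in Metric.ball p R, ENNReal.ofReal (f ‖z - p‖) =
      ∫⁻ z in Metric.ball (0 : ℂ) R, ENNReal.ofReal (f ‖z‖) := by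
    rw [← lintegral_indicator measurableSet_ball, ← lintegral_indicator measurableSet_ball,
      ← lintegral_sub_right_eq_self (Set.indicator _ fun z : ℂ => ENNReal.ofReal (f ‖z‖)) p]
    refine lintegral_congr fun z => ?_
    simp [indicator, dist_eq_norm]
  rw [h0, ← integral_ball_radial, ofReal_integral_eq_lintegral_ofReal]
  · refine (integrableOn_fun_norm_addHaar (μ := (volume : Measure ℂ))).2 ?_
    simpa [Complex.finrank_real_complex] using hint
  · exact Eventually.of_forall fun z => hf _

/-- The fundamental theorem of calculus on `Ioo`, for a continuous derivative. -/
theorem integral_Ioo_eq_sub {f F : ℝ → ℝ} {R : ℝ} (hR : 0 ≤ R) (hf : Continuous f)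
    (hF : ∀ r, HasDerivAt F (f r) r) : ∫ r in Ioo 0 R, f r = F R - F 0 := by
  rw [← integral_Ioc_eq_integral_Ioo, ← intervalIntegral.integral_of_le hR]
  exact intervalIntegral.integral_eq_sub_of_hasDerivAt (fun r _ => hF r) (hf.intervalIntegrable _ _)

theorem integrableOn_Ioo_of_continuous {f : ℝ → ℝ} (hf : Continuous f) (R : ℝ) :
    IntegrableOn f (Ioo 0 R) :=
  (hf.integrableOn_Icc (a := 0) (b := R)).mono_set Ioo_subset_Icc_self

theorem lintegral_ball_inv_sq_add {η R : ℝ} (hη : 0 < η) (hR : 0 ≤ R) (p : ℂ) :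
    ∫⁻ z in Metric.ball p R, ENNReal.ofReal (1 / (‖z - p‖ ^ 2 + η ^ 2)) =
      ENNReal.ofReal (Real.pi * Real.log ((R ^ 2 + η ^ 2) / η ^ 2)) := by
  have hpos : ∀ r : ℝ, 0 < r ^ 2 + η ^ 2 := fun r => by positivity
  have hc : Continuous fun r : ℝ => r * (1 / (r ^ 2 + η ^ 2)) :=
    continuous_id.mul (continuous_const.div (by fun_prop) fun r => (hpos r).ne')
  rw [lintegral_ball_radial (f := fun r => 1 / (r ^ 2 + η ^ 2)) (fun r => by positivity)
    (integrableOn_Ioo_of_continuous hc R),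
    integral_Ioo_eq_sub (F := fun r => 1 / 2 * Real.log (r ^ 2 + η ^ 2)) hR hc]
  · congr 1
    rw [Real.log_div (hpos R).ne' (by positivity)]
    simp
    ring
  · intro r
    have h1 : HasDerivAt (fun r : ℝ => r ^ 2 + η ^ 2) (2 * r) r := by
      simpa using (hasDerivAt_pow 2 r).add_const (η ^ 2)
    refine ((h1.log (hpos r).ne').const_mul (1 / 2)).congr_deriv ?_
    have := (hpos r).ne'
    field_simp

theorem lintegral_ball_sq_div_sq_le {ε R : ℝ} (hε : 0 < ε) (hR : 0 ≤ R) (p : ℂ) :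
    ∫⁻ z in Metric.ball p R, ENNReal.ofReal (ε ^ 2 / (‖z - p‖ ^ 2 + ε ^ 2) ^ 2) ≤
      ENNReal.ofReal Real.pi := by
  have hpos : ∀ r : ℝ, 0 < r ^ 2 + ε ^ 2 := fun r => by positivity
  have hc : Continuous fun r : ℝ => r * (ε ^ 2 / (r ^ 2 + ε ^ 2) ^ 2) :=
    continuous_id.mul (continuous_const.div (by fun_prop) fun r => (pow_pos (hpos r) 2).ne')
  rw [lintegral_ball_radial (f := fun r => ε ^ 2 / (r ^ 2 + ε ^ 2) ^ 2) (fun r => by positivity)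
    (integrableOn_Ioo_of_continuous hc R),
    integral_Ioo_eq_sub (F := fun r => -(ε ^ 2 / 2) * (r ^ 2 + ε ^ 2)⁻¹) hR hc]
  · apply ENNReal.ofReal_le_ofReal
    have h1 : 0 ≤ ε ^ 2 / 2 * (R ^ 2 + ε ^ 2)⁻¹ := by positivity
    have h2 : ε ^ 2 / 2 * (0 ^ 2 + ε ^ 2)⁻¹ = 1 / 2 := by
      have := hε.ne'
      field_simp
      ring
    have := Real.pi_pos
    nlinarith
  · intro r
    have h1 : HasDerivAt (fun r : ℝ => r ^ 2 + ε ^ 2) (2 * r) r := by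
      simpa using (hasDerivAt_pow 2 r).add_const (ε ^ 2)
    refine ((h1.fun_inv (hpos r).ne').const_mul (-(ε ^ 2 / 2))).congr_deriv ?_
    have := (hpos r).ne'
    field_simp

theorem lintegral_ball_inv_norm {R : ℝ} (hR : 0 ≤ R) (p : ℂ) :
    ∫⁻ z in Metric.ball p R, ENNReal.ofReal (1 / ‖z - p‖) ≤ ENNReal.ofReal (2 * Real.pi * R) := by
  have h : EqOn (fun r : ℝ => r * |1 / r|) (fun _ => 1) (Ioo 0 R) := fun r hr => by
    have := hr.1
    simp only [abs_of_pos (one_div_pos.2 this)]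
    field_simp
  -- The radial formula asks for a profile that is nonnegative on all of `ℝ`; the absolute value
  -- changes nothing for positive radii.
  have h1 := lintegral_ball_radial (f := fun r => |1 / r|) (R := R) (fun r => abs_nonneg _)
    ((integrableOn_congr_fun h measurableSet_Ioo).2
      (integrableOn_Ioo_of_continuous continuous_const R)) p
  rw [setIntegral_congr_fun measurableSet_Ioo h] at h1
  simp only [abs_of_nonneg (one_div_nonneg.2 (norm_nonneg _))] at h1
  rw [h1]
  simp [hR]

/-- An open set in a closed half plane lies in the open half plane. -/
theorem inner_pos_of_mem_open {Ω : Set ℂ} (hΩ : IsOpen Ω) {e p : ℂ} (he : ‖e‖ = 1)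
    (h : ∀ z ∈ Ω, 0 ≤ inner ℝ e (z - p)) {z : ℂ} (hz : z ∈ Ω) : 0 < inner ℝ e (z - p) := by
  have hcont : ContinuousAt (fun r : ℝ => z - r * e) 0 := by fun_prop
  have hev : ∀ᶠ r : ℝ in 𝓝[>] 0, z - r * e ∈ Ω :=
    (hcont.eventually (hΩ.mem_nhds (by simpa using hz))).filter_mono nhdsWithin_le_nhds
  obtain ⟨r, hr, hr0⟩ := (hev.and self_mem_nhdsWithin).exists
  have h1 := h _ hr
  rw [show z - r * e - p = (z - p) - r * e by ring, inner_sub_right, ← Complex.real_smul,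
    inner_smul_right, real_inner_self_eq_norm_sq, he] at h1
  have : 0 < r := hr0
  linarith

/-- Reflection in `p` preserves the integrand and moves `Ω` to the opposite open half plane. The two
disjoint copies fit into one disc, which halves the constant `π`. -/
theorem lintegral_halfPlane_inv_sq_add {Ω : Set ℂ} (hΩ : IsOpen Ω) {e p : ℂ} (he : ‖e‖ = 1)
    (h : ∀ z ∈ Ω, 0 ≤ inner ℝ e (z - p)) {η R : ℝ} (hη : 0 < η) (hR : 0 ≤ R)
    (hΩR : Ω ⊆ Metric.ball p R) :
    ∫⁻ z in Ω, ENNReal.ofReal (1 / (‖z - p‖ ^ 2 + η ^ 2)) ≤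
      ENNReal.ofReal (Real.pi / 2 * Real.log ((R ^ 2 + η ^ 2) / η ^ 2)) := by
  let σ : ℂ → ℂ := fun z => (p + p) - z
  have hσ : MeasurePreserving σ volume volume :=
    Measure.measurePreserving_sub_left volume (p + p)
  have hσe : MeasurableEmbedding σ := (MeasurableEquiv.subLeft (p + p)).measurableEmbedding
  have hσm : MeasurableSet (σ ⁻¹' Ω) := hσ.measurable hΩ.measurableSet
  have hsym : ∀ z, ‖σ z - p‖ = ‖z - p‖ := fun z => by
    simp only [σ]; rw [← norm_neg]; congr 1; ring
  set f : ℂ → ℝ≥0∞ := fun z => ENNReal.ofReal (1 / (‖z - p‖ ^ 2 + η ^ 2)) with hf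
  have h1 : ∫⁻ z in σ ⁻¹' Ω, f z = ∫⁻ z in Ω, f z := by
    rw [← hσ.setLIntegral_comp_preimage_emb hσe f Ω]
    simp only [hf, hsym]
  have hdisj : Disjoint Ω (σ ⁻¹' Ω) := by
    rw [Set.disjoint_left]
    intro z hz hz'
    have e1 := inner_pos_of_mem_open hΩ he h hz
    have e2 := inner_pos_of_mem_open hΩ he h hz'
    rw [show σ z - p = -(z - p) by simp only [σ]; ring, inner_neg_right] at e2
    linarith
  have h2 : (∫⁻ z in Ω, f z) + ∫⁻ z in Ω, f z ≤ ∫⁻ z in Metric.ball p R, f z := by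
    conv_lhs => rw [← h1]
    rw [h1]
    nth_rewrite 2 [← h1]
    rw [← lintegral_union hσm hdisj]
    refine lintegral_mono_set (union_subset hΩR fun z hz => ?_)
    have := hΩR hz
    rw [mem_ball_iff_norm, hsym] at this
    rwa [mem_ball_iff_norm]
  rw [hf, lintegral_ball_inv_sq_add hη hR, ← two_mul] at h2
  have h3 : Real.pi * Real.log ((R ^ 2 + η ^ 2) / η ^ 2) =
      2 * (Real.pi / 2 * Real.log ((R ^ 2 + η ^ 2) / η ^ 2)) := by ring
  rw [h3, ENNReal.ofReal_mul (by norm_num), ENNReal.ofReal_ofNat] at h2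
  exact (ENNReal.mul_le_mul_iff_right (by norm_num) (by norm_num)).1 h2

/-! ### Smooth functions as Sobolev functions, traces and boundary measure -/

theorem memLp_of_continuous {μ : Measure ℂ} [IsFiniteMeasure μ] {K : Set ℂ} (hK : IsCompact K)
    (hμ : ∀ᵐ z ∂μ, z ∈ K) {f : ℂ → ℂ} (hf : Continuous f) (p : ℝ≥0∞) : MemLp f p μ := by
  obtain ⟨C, hC⟩ := hK.exists_bound_of_continuousOn hf.continuousOn
  exact MemLp.of_bound hf.aestronglyMeasurable C (hμ.mono hC)

theorem isFiniteMeasure_restrict_of_isBounded {Ω : Set ℂ} (hΩ : Bornology.IsBounded Ω) :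
    IsFiniteMeasure (volume.restrict Ω) :=
  ⟨by rw [Measure.restrict_apply_univ]; exact hΩ.measure_lt_top⟩

theorem isWeakDeriv_fderiv {Ω : Set ℂ} {u : ℂ → ℂ} (hu : ContDiff ℝ 1 u) (e : ℂ) :
    IsWeakDeriv Ω e u (fun z => fderiv ℝ u z e) := by
  intro φ hφ hφc hφΩ
  have hφd : Continuous fun z => fderiv ℝ φ z e :=
    (hφ.continuous_fderiv (by simp)).clm_apply continuous_const
  have hud : Continuous fun z => fderiv ℝ u z e :=
    (hu.continuous_fderiv (by simp)).clm_apply continuous_const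
  have hφ0 : ∀ z ∉ Ω, φ z = 0 := fun z hz => image_eq_zero_of_notMem_tsupport fun h => hz (hφΩ h)
  have hφd0 : ∀ z ∉ Ω, fderiv ℝ φ z e = 0 := fun z hz => by
    rw [image_eq_zero_of_notMem_tsupport (f := fderiv ℝ φ)
      fun h => hz (hφΩ (tsupport_fderiv_subset ℝ h))]
    rfl
  have hφdc : HasCompactSupport fun z => fderiv ℝ φ z e := hφc.fderiv_apply (𝕜 := ℝ) e
  rw [setIntegral_eq_integral_of_forall_compl_eq_zero (fun z hz => by rw [hφd0 z hz, zero_smul]),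
    setIntegral_eq_integral_of_forall_compl_eq_zero (fun z hz => by rw [hφ0 z hz, zero_smul])]
  rw [integral_smul_fderiv_eq_neg_fderiv_smul_of_integrable, neg_neg]
  · exact (hφd.smul hu.continuous).integrable_of_hasCompactSupport hφdc.smul_right
  · exact (hφ.continuous.smul hud).integrable_of_hasCompactSupport hφc.smul_right
  · exact (hφ.continuous.smul hu.continuous).integrable_of_hasCompactSupport hφc.smul_right
  · exact fun z _ => hφ.differentiable (by simp) z
  · exact fun z _ => hu.differentiable (by simp) z

/-- The restriction to a bounded set of a `C¹` function on the plane. -/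
noncomputable def H1.ofContDiff {Ω : Set ℂ} (hΩm : MeasurableSet Ω) (hΩ : Bornology.IsBounded Ω)
    (u : ℂ → ℂ) (hu : ContDiff ℝ 1 u) : H1 Ω :=
  have := isFiniteMeasure_restrict_of_isBounded hΩ
  have hK : ∀ᵐ z ∂volume.restrict Ω, z ∈ closure Ω :=
    (ae_restrict_mem hΩm).mono fun _ h => subset_closure h
  have hud : ∀ e, Continuous fun z => fderiv ℝ u z e := fun _ =>
    (hu.continuous_fderiv (by simp)).clm_apply continuous_const
  { toFun := u
    dx := fun z => fderiv ℝ u z 1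
    dy := fun z => fderiv ℝ u z Complex.I
    memLp_toFun := memLp_of_continuous hΩ.isCompact_closure hK hu.continuous 2
    memLp_dx := memLp_of_continuous hΩ.isCompact_closure hK (hud _) 2
    memLp_dy := memLp_of_continuous hΩ.isCompact_closure hK (hud _) 2
    weak_dx := isWeakDeriv_fderiv hu 1
    weak_dy := isWeakDeriv_fderiv hu Complex.I }

/-- Arc length on the boundary is dominated by the parameter measure. -/
theorem exists_bdryMeasure_le {Ω : Set ℂ} {γ : ℝ → ℂ} (hγ : ContDiff ℝ 1 γ)
    (hper : Function.Periodic γ 1) (hrange : range γ = frontier Ω) :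
    ∃ K : ℝ≥0, ∀ a : ℝ,
      bdryMeasure Ω ≤ (K : ℝ≥0∞) • (volume.restrict (Ioc a (a + 1))).map γ := by
  obtain ⟨C, hC⟩ := (isCompact_Icc (a := (0 : ℝ)) (b := 1)).exists_bound_of_continuousOn
    (hγ.continuous_deriv (by simp)).continuousOn
  have hderper : ∀ t, deriv γ (t + 1) = deriv γ t := fun t => by
    rw [← deriv_comp_add_const]; congr 1; exact funext hper
  have hLip : LipschitzWith C.toNNReal γ := by
    refine lipschitzWith_of_nnnorm_deriv_le (hγ.differentiable (by simp)) fun t => ?_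
    have hp : Function.Periodic (deriv γ) 1 := hderper
    obtain ⟨s, hs, hst⟩ := hp.exists_mem_Ico₀ one_pos t
    rw [hst, ← NNReal.coe_le_coe]
    exact (hC s ⟨hs.1, hs.2.le⟩).trans (Real.le_coe_toNNReal C)
  -- The constant does not depend on the parameter window, which can therefore be centred at a
  -- vortex later.
  refine ⟨C.toNNReal, fun a => Measure.le_iff.2 fun A hA => ?_⟩
  have hsub : A ∩ frontier Ω ⊆ γ '' (γ ⁻¹' A ∩ Ioc a (a + 1)) := by
    rintro z ⟨hzA, hz⟩
    rw [← hrange] at hz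
    obtain ⟨t, rfl⟩ := hz
    obtain ⟨s, hs, hst⟩ := hper.exists_mem_Ioc one_pos t a
    exact ⟨s, ⟨by rw [mem_preimage, ← hst]; exact hzA, hs⟩, hst.symm⟩
  have hm : MeasurableSet (γ ⁻¹' A) := hγ.continuous.measurable hA
  calc bdryMeasure Ω A = Measure.hausdorffMeasure 1 (A ∩ frontier Ω) := by
        rw [bdryMeasure, Measure.restrict_apply hA]
    _ ≤ Measure.hausdorffMeasure 1 (γ '' (γ ⁻¹' A ∩ Ioc a (a + 1))) := measure_mono hsub
    _ ≤ (C.toNNReal : ℝ≥0∞) ^ (1 : ℝ) * Measure.hausdorffMeasure 1 (γ ⁻¹' A ∩ Ioc a (a + 1)) :=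
        hLip.hausdorffMeasure_image_le zero_le_one _
    _ = _ := by
        rw [ENNReal.rpow_one, hausdorffMeasure_real, Measure.smul_apply, smul_eq_mul,
          Measure.map_apply hγ.continuous.measurable hA, Measure.restrict_apply hm]

theorem isFiniteMeasure_bdryMeasure {Ω : Set ℂ} {γ : ℝ → ℂ} (hγ : ContDiff ℝ 1 γ)
    (hper : Function.Periodic γ 1) (hrange : range γ = frontier Ω) :
    IsFiniteMeasure (bdryMeasure Ω) := by
  obtain ⟨K, hK⟩ := exists_bdryMeasure_le hγ hper hrange
  refine ⟨(hK 0 univ).trans_lt ?_⟩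
  rw [Measure.smul_apply, Measure.map_apply hγ.continuous.measurable MeasurableSet.univ]
  simp

theorem isTrace_ofContDiff {Ω : Set ℂ} (hΩm : MeasurableSet Ω) (hΩ : Bornology.IsBounded Ω)
    [IsFiniteMeasure (bdryMeasure Ω)] (u : ℂ → ℂ) (hu : ContDiff ℝ 1 u) :
    IsTrace Ω (H1.ofContDiff hΩm hΩ u hu) u := by
  have hK : ∀ᵐ z ∂bdryMeasure Ω, z ∈ closure Ω :=
    (ae_restrict_mem isClosed_frontier.measurableSet).mono fun _ h => frontier_subset_closure h
  refine ⟨memLp_of_continuous hΩ.isCompact_closure hK hu.continuous 2, fun _ => u, fun _ => hu, ?_⟩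
  simp [H1.ofContDiff]

/-! ### Regularized vortices and their energy density -/

/-- The regularized vortex `w / √(|w|² + ε²)`. -/
noncomputable def vortex (ε : ℝ) (w : ℂ) : ℂ := (√(‖w‖ ^ 2 + ε ^ 2))⁻¹ • w

theorem norm_sq_add_sq_pos {ε : ℝ} (hε : 0 < ε) (w : ℂ) : 0 < ‖w‖ ^ 2 + ε ^ 2 := by positivity

theorem contDiff_vortex {ε : ℝ} (hε : 0 < ε) : ContDiff ℝ 1 (vortex ε) := by
  have h1 : ContDiff ℝ 1 fun w : ℂ => √(‖w‖ ^ 2 + ε ^ 2) :=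
    ((contDiff_norm_sq ℝ).add contDiff_const).sqrt fun w => (norm_sq_add_sq_pos hε w).ne'
  exact (h1.inv fun w => (Real.sqrt_pos.2 (norm_sq_add_sq_pos hε w)).ne').smul contDiff_id

theorem one_sub_norm_vortex_sq {ε : ℝ} (hε : 0 < ε) (w : ℂ) :
    1 - ‖vortex ε w‖ ^ 2 = ε ^ 2 / (‖w‖ ^ 2 + ε ^ 2) := by
  have hN := norm_sq_add_sq_pos hε w
  rw [vortex, norm_smul, norm_inv, Real.norm_eq_abs, abs_of_nonneg (Real.sqrt_nonneg _), mul_pow,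
    inv_pow, Real.sq_sqrt hN.le]
  field_simp
  ring

theorem norm_vortex_le_one {ε : ℝ} (hε : 0 < ε) (w : ℂ) : ‖vortex ε w‖ ≤ 1 := by
  have h1 := one_sub_norm_vortex_sq hε w
  have h2 : 0 ≤ ε ^ 2 / (‖w‖ ^ 2 + ε ^ 2) := by positivity
  have h3 : ‖vortex ε w‖ ^ 2 ≤ 1 ^ 2 := by linarith
  exact (sq_le_sq₀ (norm_nonneg _) zero_le_one).1 h3

/-- With `N = |w|² + ε²` the squared gradient is exactly `1/N + ε⁴/N³`, and `ε² ≤ N`. The first term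
produces the logarithm, the second has bounded integral. -/
theorem hasFDerivAt_vortex {ε : ℝ} (hε : 0 < ε) (w : ℂ) :
    ∃ L : ℂ →L[ℝ] ℂ, HasFDerivAt (vortex ε) L w ∧
      ‖L 1‖ ^ 2 + ‖L Complex.I‖ ^ 2 ≤
        1 / (‖w‖ ^ 2 + ε ^ 2) + ε ^ 2 / (‖w‖ ^ 2 + ε ^ 2) ^ 2 := by
  have hN := norm_sq_add_sq_pos hε w
  set N := ‖w‖ ^ 2 + ε ^ 2 with hNdef
  have h1 : HasFDerivAt (fun w : ℂ => ‖w‖ ^ 2 + ε ^ 2) (2 • innerSL ℝ w) w :=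
    (hasStrictFDerivAt_norm_sq w).hasFDerivAt.add_const _
  set S := (√N)⁻¹ with hS
  have hS2 : S ^ 2 = 1 / N := by rw [hS, inv_pow, Real.sq_sqrt hN.le, one_div]
  have hSN : HasDerivAt (fun x : ℝ => (√x)⁻¹) (-(S ^ 3 / 2)) N := by
    refine ((Real.hasDerivAt_sqrt hN.ne').fun_inv (Real.sqrt_pos.2 hN).ne').congr_deriv ?_
    rw [hS]
    have := (Real.sqrt_pos.2 hN).ne'
    field_simp
  have h2 := (hSN.comp_hasFDerivAt w h1).smul (hasFDerivAt_id (𝕜 := ℝ) w)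
  refine ⟨_, h2, ?_⟩
  have hw : w.re ^ 2 + w.im ^ 2 = N - ε ^ 2 := by
    rw [hNdef, Complex.sq_norm, Complex.normSq_apply]; ring
  have hin1 : (innerSL ℝ w) 1 = w.re := by simp
  have hinI : (innerSL ℝ w) Complex.I = w.im := by simp
  have hS2N : S ^ 2 * N = 1 := by rw [hS2]; field_simp
  have key : ‖(S : ℂ) - S ^ 3 * w.re * w‖ ^ 2 + ‖(S : ℂ) * Complex.I - S ^ 3 * w.im * w‖ ^ 2 =
      S ^ 2 + ε ^ 4 * S ^ 6 := by
    simp only [Complex.sq_norm, Complex.normSq_apply, Complex.sub_re, Complex.sub_im,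
      Complex.mul_re, Complex.mul_im, ← Complex.ofReal_pow, Complex.ofReal_re, Complex.ofReal_im,
      Complex.I_re, Complex.I_im]
    have h5 : S ^ 2 * (w.re ^ 2 + w.im ^ 2) = 1 - ε ^ 2 * S ^ 2 := by
      rw [hw]; linear_combination hS2N
    linear_combination (S ^ 2 * (S ^ 2 * (w.re ^ 2 + w.im ^ 2) + 1 - ε ^ 2 * S ^ 2) - 2 * S ^ 2) * h5
  have h1' : ε ^ 4 * S ^ 6 ≤ ε ^ 2 * S ^ 4 := by
    have h6 : ε ^ 2 * S ^ 2 ≤ 1 := by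
      have : 0 ≤ ‖w‖ ^ 2 * S ^ 2 := by positivity
      rw [hNdef] at hS2N
      linarith
    have h7 : 0 ≤ ε ^ 2 * S ^ 4 := by positivity
    calc ε ^ 4 * S ^ 6 = (ε ^ 2 * S ^ 4) * (ε ^ 2 * S ^ 2) := by ring
      _ ≤ (ε ^ 2 * S ^ 4) * 1 := by gcongr
      _ = _ := mul_one _
  have h4 : ε ^ 2 * S ^ 4 = ε ^ 2 / N ^ 2 := by
    rw [show S ^ 4 = (S ^ 2) ^ 2 by ring, hS2]; field_simp
  rw [← hS2, ← h4]
  refine le_trans (le_of_eq ?_) (key.trans_le (by linarith))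
  simp only [add_apply, smul_apply, Function.comp_apply,
    ContinuousLinearMap.smulRight_apply, ContinuousLinearMap.id_apply, nsmul_eq_mul, hin1, hinI,
    ← hNdef, ← hS, Complex.real_smul, smul_eq_mul, id_eq]
  congr 3
  · push_cast; ring
  · push_cast; ring

/-- The product of the phase factor `exp (i ψ)` and regularized vortices at the points `q j`. -/
noncomputable def vortexProduct {n : ℕ} (ψ : ℂ → ℝ) (q : Fin n → ℂ) (ε : ℝ) (z : ℂ) : ℂ :=
  Complex.exp (ψ z * Complex.I) * ∏ j, vortex ε (z - q j)

theorem contDiff_vortexProduct {n : ℕ} {ψ : ℂ → ℝ} (hψ : ContDiff ℝ 1 ψ) (q : Fin n → ℂ) {ε : ℝ}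
    (hε : 0 < ε) : ContDiff ℝ 1 (vortexProduct ψ q ε) := by
  have h1 : ContDiff ℝ 1 fun z => Complex.exp (ψ z * Complex.I) :=
    ((Complex.ofRealCLM.contDiff.comp hψ).mul contDiff_const).cexp
  exact h1.mul (contDiff_prod fun j _ =>
    (contDiff_vortex hε).comp (contDiff_id.sub contDiff_const))

theorem norm_vortexProduct {n : ℕ} (ψ : ℂ → ℝ) (q : Fin n → ℂ) (ε : ℝ) (z : ℂ) :
    ‖vortexProduct ψ q ε z‖ = ∏ j, ‖vortex ε (z - q j)‖ := by
  rw [vortexProduct, norm_mul, Complex.norm_exp_ofReal_mul_I, one_mul, norm_prod]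

theorem one_sub_prod_le_sum {ι : Type*} (s : Finset ι) {x : ι → ℝ} (h0 : ∀ i, 0 ≤ x i)
    (h1 : ∀ i, x i ≤ 1) : 1 - ∏ i ∈ s, x i ≤ ∑ i ∈ s, (1 - x i) := by
  classical
  induction s using Finset.induction_on with
  | empty => simp
  | insert a s ha ih =>
    rw [Finset.prod_insert ha, Finset.sum_insert ha]
    have h2 : 0 ≤ ∏ i ∈ s, x i := Finset.prod_nonneg fun i _ => h0 i
    have h3 : ∏ i ∈ s, x i ≤ 1 := Finset.prod_le_one (fun i _ => h0 i) fun i _ => h1 i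
    nlinarith [h0 a, h1 a]

/-- The defect `1 - |u|²` of a product is at most the sum of the defects of its factors;
Cauchy–Schwarz then gives the factor `n`. -/
theorem sq_one_sub_norm_vortexProduct_le {n : ℕ} (ψ : ℂ → ℝ) (q : Fin n → ℂ) {ε : ℝ} (hε : 0 < ε)
    (z : ℂ) : (1 - ‖vortexProduct ψ q ε z‖ ^ 2) ^ 2 ≤
      n * ∑ j, (ε ^ 2 / (‖z - q j‖ ^ 2 + ε ^ 2)) ^ 2 := by
  rw [norm_vortexProduct, ← Finset.prod_pow]
  have h0 : ∀ j, 0 ≤ ‖vortex ε (z - q j)‖ ^ 2 := fun j => by positivity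
  have h1 : ∀ j, ‖vortex ε (z - q j)‖ ^ 2 ≤ 1 := fun j =>
    pow_le_one₀ (norm_nonneg _) (norm_vortex_le_one hε _)
  have h2 := one_sub_prod_le_sum Finset.univ h0 h1
  have h3 : ∏ j, ‖vortex ε (z - q j)‖ ^ 2 ≤ 1 :=
    Finset.prod_le_one (fun i _ => h0 i) fun i _ => h1 i
  simp only [one_sub_norm_vortex_sq hε] at h2
  have h4 := sq_sum_le_card_mul_sum_sq (s := Finset.univ)
    (f := fun j => ε ^ 2 / (‖z - q j‖ ^ 2 + ε ^ 2))
  rw [Finset.card_univ, Fintype.card_fin] at h4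
  exact (pow_le_pow_left₀ (by linarith) h2 2).trans h4

/-- In the product rule every undifferentiated factor has modulus at most one. -/
theorem norm_fderiv_vortexProduct_le {n : ℕ} {ψ : ℂ → ℝ} (hψ : ContDiff ℝ 1 ψ) (q : Fin n → ℂ)
    {ε : ℝ} (hε : 0 < ε) (z : ℂ) {L : Fin n → ℂ →L[ℝ] ℂ}
    (hL : ∀ j, HasFDerivAt (vortex ε) (L j) (z - q j)) (h : ℂ) :
    ‖fderiv ℝ (vortexProduct ψ q ε) z h‖ ≤ ‖fderiv ℝ ψ z h‖ + ∑ j, ‖L j h‖ := by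
  classical
  have hψd : HasFDerivAt ψ (fderiv ℝ ψ z) z := (hψ.differentiable (by simp) z).hasFDerivAt
  have h1 : HasFDerivAt (fun z => Complex.exp (ψ z * Complex.I))
      (Complex.exp (ψ z * Complex.I) • ((Complex.I : ℂ) • (Complex.ofRealCLM.comp (fderiv ℝ ψ z))))
      z := ((Complex.ofRealCLM.hasFDerivAt.comp z hψd).mul_const Complex.I).cexp
  have h2 : ∀ j ∈ (Finset.univ : Finset (Fin n)),
      HasFDerivAt (fun z => vortex ε (z - q j)) (L j) z := fun j _ => by
    exact (hL j).comp z ((hasFDerivAt_id z).sub_const (q j))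
  have h3 := h1.mul (HasFDerivAt.finsetProd h2)
  have h4 : HasFDerivAt (vortexProduct ψ q ε) _ z := h3
  have hprod : ∀ s : Finset (Fin n), ‖∏ j ∈ s, vortex ε (z - q j)‖ ≤ 1 := fun s => by
    rw [norm_prod]
    exact Finset.prod_le_one (fun _ _ => norm_nonneg _) fun _ _ => norm_vortex_le_one hε _
  rw [h4.fderiv]
  simp only [add_apply, smul_apply, sum_apply, ContinuousLinearMap.comp_apply, smul_eq_mul,
    Complex.ofRealCLM_apply]
  rw [add_comm]
  refine (norm_add_le _ _).trans (add_le_add ?_ ?_)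
  · rw [norm_mul, norm_mul, norm_mul, Complex.norm_I, Complex.norm_exp_ofReal_mul_I, one_mul,
      one_mul, Complex.norm_real]
    exact mul_le_of_le_one_left (norm_nonneg _) (hprod _)
  · rw [norm_mul, Complex.norm_exp_ofReal_mul_I, one_mul]
    refine (norm_sum_le _ _).trans (Finset.sum_le_sum fun j _ => ?_)
    rw [norm_mul]
    exact mul_le_of_le_one_left (norm_nonneg _) (hprod _)

/-- The square of a sum of singular terms is the sum of the squares up to terms with weaker
singularities. -/
theorem sq_add_sum_le {n : ℕ} {m M κ : ℝ} {b T : Fin n → ℝ} (hm0 : 0 ≤ m) (hm : m ≤ M)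
    (hb0 : ∀ j, 0 ≤ b j) (hb : ∀ j, b j ≤ 2 * T j)
    (hT : ∀ j k, j ≠ k → T j * T k ≤ κ * (T j + T k)) (hκ : 0 ≤ κ) :
    (m + ∑ j, b j) ^ 2 ≤ ∑ j, b j ^ 2 + M ^ 2 + (4 * M + 8 * n * κ) * ∑ j, T j := by
  have hT0 : ∀ j, 0 ≤ T j := fun j => by linarith [hb0 j, hb j]
  have h1 : (∑ j, b j) ^ 2 ≤ ∑ j, b j ^ 2 + 8 * n * κ * ∑ j, T j := by
    have h2 : ∀ j k, b j * b k ≤ (if j = k then b j ^ 2 else 0) + 4 * κ * (T j + T k) := by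
      intro j k
      have h3 : 0 ≤ 4 * κ * (T j + T k) :=
        mul_nonneg (by positivity) (add_nonneg (hT0 j) (hT0 k))
      by_cases hjk : j = k
      · subst hjk; rw [if_pos rfl]; nlinarith
      · rw [if_neg hjk]
        have h4 : b j * b k ≤ (2 * T j) * (2 * T k) :=
          mul_le_mul (hb j) (hb k) (hb0 k) (by linarith [hT0 j])
        linarith [hT j k hjk]
    calc (∑ j, b j) ^ 2 = ∑ j, ∑ k, b j * b k := by rw [sq, Finset.sum_mul_sum]
      _ ≤ ∑ j, ∑ k, ((if j = k then b j ^ 2 else 0) + 4 * κ * (T j + T k)) :=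
          Finset.sum_le_sum fun j _ => Finset.sum_le_sum fun k _ => h2 j k
      _ = _ := by
          simp only [Finset.sum_add_distrib, ← Finset.mul_sum, Finset.sum_ite_eq, Finset.mem_univ,
            if_true, Finset.sum_const, Finset.card_univ, Fintype.card_fin, nsmul_eq_mul]
          ring
  have h5 : ∑ j, b j ≤ 2 * ∑ j, T j := by
    rw [Finset.mul_sum]; exact Finset.sum_le_sum fun j _ => hb j
  have h6 : 0 ≤ ∑ j, b j := Finset.sum_nonneg fun j _ => hb0 j
  have h7 : m * ∑ j, b j ≤ M * (2 * ∑ j, T j) := mul_le_mul hm h5 h6 (hm0.trans hm)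
  have h8 : m ^ 2 ≤ M ^ 2 := pow_le_pow_left₀ hm0 hm 2
  nlinarith

/-- The energy density of a product of vortices, at a point `z` which is at least as close to the
points `p j` as to the vortices `q j`. -/
theorem density_vortexProduct_le {n : ℕ} {ψ : ℂ → ℝ} (hψ : ContDiff ℝ 1 ψ) {p q : Fin n → ℂ}
    {ε η κ M : ℝ} (hε : 0 < ε) (hη : 0 < η) (hκ : 0 ≤ κ) {z : ℂ}
    (hzp : ∀ j, z ≠ p j) (hpq : ∀ j, ‖z - p j‖ ^ 2 + η ^ 2 ≤ ‖z - q j‖ ^ 2 + ε ^ 2)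
    (hM : ‖fderiv ℝ ψ z‖ ≤ M)
    (hT : ∀ j k, j ≠ k →
      1 / ‖z - p j‖ * (1 / ‖z - p k‖) ≤ κ * (1 / ‖z - p j‖ + 1 / ‖z - p k‖)) :
    ‖fderiv ℝ (vortexProduct ψ q ε) z 1‖ ^ 2 + ‖fderiv ℝ (vortexProduct ψ q ε) z Complex.I‖ ^ 2 +
      1 / (2 * ε ^ 2) * (1 - ‖vortexProduct ψ q ε z‖ ^ 2) ^ 2 ≤
    ∑ j, 1 / (‖z - p j‖ ^ 2 + η ^ 2) + (2 * M ^ 2 +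
      (2 * (4 * M + 8 * n * κ) * ∑ j, 1 / ‖z - p j‖ +
        (1 + n / 2) * ∑ j, ε ^ 2 / (‖z - q j‖ ^ 2 + ε ^ 2) ^ 2)) := by
  choose L hL hLn using fun j => hasFDerivAt_vortex hε (z - q j)
  have hN : ∀ j, 0 < ‖z - q j‖ ^ 2 + ε ^ 2 := fun j => norm_sq_add_sq_pos hε _
  have hP : ∀ j, 0 < ‖z - p j‖ := fun j => norm_pos_iff.2 (sub_ne_zero.2 (hzp j))
  have hpq' : ∀ j, ‖z - p j‖ ^ 2 ≤ ‖z - q j‖ ^ 2 + ε ^ 2 := fun j => by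
    nlinarith [hpq j]
  -- The lossy factor `2` only affects the cross terms; the squares, which carry the logarithm, keep
  -- the sharp bound from `hLn`.
  have hLb : ∀ j, ‖L j 1‖ ^ 2 + ‖L j Complex.I‖ ^ 2 ≤ (2 * (1 / ‖z - p j‖)) ^ 2 := by
    intro j
    refine (hLn j).trans ?_
    have h1 : 1 / (‖z - q j‖ ^ 2 + ε ^ 2) ≤ 1 / ‖z - p j‖ ^ 2 :=
      one_div_le_one_div_of_le (pow_pos (hP j) 2) (hpq' j)
    have h2 : ε ^ 2 / (‖z - q j‖ ^ 2 + ε ^ 2) ^ 2 ≤ 1 / (‖z - q j‖ ^ 2 + ε ^ 2) := by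
      rw [div_le_div_iff₀ (pow_pos (hN j) 2) (hN j)]
      have : 0 ≤ ‖z - q j‖ ^ 2 := by positivity
      nlinarith [hN j]
    have h3 : (2 * (1 / ‖z - p j‖)) ^ 2 = 4 * (1 / ‖z - p j‖ ^ 2) := by
      rw [mul_pow, div_pow]; norm_num
    have h4 : 0 < 1 / ‖z - p j‖ ^ 2 := by have := hP j; positivity
    rw [h3]; linarith
  have hb : ∀ h : ℂ, (h = 1 ∨ h = Complex.I) → ‖fderiv ℝ (vortexProduct ψ q ε) z h‖ ^ 2 ≤
      ∑ j, ‖L j h‖ ^ 2 + M ^ 2 + (4 * M + 8 * n * κ) * ∑ j, 1 / ‖z - p j‖ := by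
    intro h hh
    have hn : ‖h‖ = 1 := by rcases hh with rfl | rfl <;> simp
    refine (pow_le_pow_left₀ (norm_nonneg _)
      (norm_fderiv_vortexProduct_le hψ q hε z hL h) 2).trans ?_
    refine sq_add_sum_le (norm_nonneg _) ?_ (fun j => norm_nonneg _) (fun j => ?_) hT hκ
    · refine ((fderiv ℝ ψ z).le_opNorm h).trans ?_
      rw [hn, mul_one]; exact hM
    · refine (sq_le_sq₀ (norm_nonneg _) (by have := hP j; positivity)).1 (le_trans ?_ (hLb j))
      rcases hh with rfl | rfl
      · linarith [sq_nonneg ‖L j Complex.I‖]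
      · linarith [sq_nonneg ‖L j 1‖]
  have h1 := hb 1 (Or.inl rfl)
  have h2 := hb Complex.I (Or.inr rfl)
  have h3 : ∑ j, ‖L j 1‖ ^ 2 + ∑ j, ‖L j Complex.I‖ ^ 2 ≤
      ∑ j, 1 / (‖z - p j‖ ^ 2 + η ^ 2) + ∑ j, ε ^ 2 / (‖z - q j‖ ^ 2 + ε ^ 2) ^ 2 := by
    rw [← Finset.sum_add_distrib, ← Finset.sum_add_distrib]
    refine Finset.sum_le_sum fun j _ => (hLn j).trans ?_
    exact add_le_add (one_div_le_one_div_of_le (by positivity) (hpq j)) le_rfl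
  have h4 : 1 / (2 * ε ^ 2) * (1 - ‖vortexProduct ψ q ε z‖ ^ 2) ^ 2 ≤
      n / 2 * ∑ j, ε ^ 2 / (‖z - q j‖ ^ 2 + ε ^ 2) ^ 2 := by
    calc _ ≤ 1 / (2 * ε ^ 2) * (n * ∑ j, (ε ^ 2 / (‖z - q j‖ ^ 2 + ε ^ 2)) ^ 2) := by
          gcongr; exact sq_one_sub_norm_vortexProduct_le ψ q hε z
      _ = _ := by
          simp only [Finset.mul_sum]
          refine Finset.sum_congr rfl fun j _ => ?_
          have := (hN j).ne'
          field_simp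
  linarith

/-! ### Energy of the competitor -/

/-- `f` is measurable and the integral of its positive part is at most `c ≥ 0`. -/
structure HasIntegralBound (μ : Measure ℂ) (f : ℂ → ℝ) (c : ℝ) : Prop where
  measurable : Measurable f
  nonneg : 0 ≤ c
  le : ∫⁻ z, ENNReal.ofReal (f z) ∂μ ≤ ENNReal.ofReal c

namespace HasIntegralBound

variable {μ : Measure ℂ} {f g : ℂ → ℝ} {a b : ℝ}

theorem add (hf : HasIntegralBound μ f a) (hg : HasIntegralBound μ g b) :
    HasIntegralBound μ (fun z => f z + g z) (a + b) where
  measurable := hf.measurable.add hg.measurable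
  nonneg := add_nonneg hf.nonneg hg.nonneg
  le := by
    rw [ENNReal.ofReal_add hf.nonneg hg.nonneg]
    refine le_trans (lintegral_mono fun z => ENNReal.ofReal_add_le) ?_
    rw [lintegral_add_left hf.measurable.ennreal_ofReal]
    exact add_le_add hf.le hg.le

theorem const_mul (hf : HasIntegralBound μ f a) {k : ℝ} (hk : 0 ≤ k) :
    HasIntegralBound μ (fun z => k * f z) (k * a) where
  measurable := hf.measurable.const_mul k
  nonneg := mul_nonneg hk hf.nonneg
  le := by
    simp only [ENNReal.ofReal_mul hk]
    rw [lintegral_const_mul _ hf.measurable.ennreal_ofReal]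
    gcongr
    exact hf.le

theorem sum {n : ℕ} {F : Fin n → ℂ → ℝ} {c : Fin n → ℝ}
    (h : ∀ j, HasIntegralBound μ (F j) (c j)) :
    HasIntegralBound μ (fun z => ∑ j, F j z) (∑ j, c j) := by
  suffices ∀ s : Finset (Fin n), HasIntegralBound μ (fun z => ∑ j ∈ s, F j z) (∑ j ∈ s, c j) from
    this _
  intro s
  induction s using Finset.induction_on with
  | empty => exact ⟨by simp, by simp, by simp⟩
  | insert i s hi ih =>
    simp only [Finset.sum_insert hi]
    exact (h i).add ih

theorem const [IsFiniteMeasure μ] {k : ℝ} (hk : 0 ≤ k) :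
    HasIntegralBound μ (fun _ => k) (k * μ.real univ) where
  measurable := measurable_const
  nonneg := by positivity
  le := by
    rw [lintegral_const, ENNReal.ofReal_mul hk, measureReal_def,
      ENNReal.ofReal_toReal (measure_ne_top _ _)]

theorem le_of_ae_le (hf : HasIntegralBound μ f a) (h : ∀ᵐ z ∂μ, g z ≤ f z) :
    ∫⁻ z, ENNReal.ofReal (g z) ∂μ ≤ ENNReal.ofReal a :=
  (lintegral_mono_ae (h.mono fun _ hz => ENNReal.ofReal_le_ofReal hz)).trans hf.le

end HasIntegralBound

/-- From `|p j - p k| ≤ |z - p j| + |z - p k|`, after division by all three distances. Thus a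
product of two singularities at distinct points is no worse than their sum. -/
theorem exists_separation_bound {n : ℕ} {p : Fin n → ℂ} (hp : Function.Injective p) :
    ∃ κ : ℝ, 0 ≤ κ ∧ ∀ z, (∀ j, z ≠ p j) → ∀ j k, j ≠ k →
      1 / ‖z - p j‖ * (1 / ‖z - p k‖) ≤ κ * (1 / ‖z - p j‖ + 1 / ‖z - p k‖) := by
  refine ⟨∑ j, ∑ k, 1 / ‖p j - p k‖, by positivity, fun z hz j k hjk => ?_⟩
  have hj : 0 < ‖z - p j‖ := norm_pos_iff.2 (sub_ne_zero.2 (hz j))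
  have hk : 0 < ‖z - p k‖ := norm_pos_iff.2 (sub_ne_zero.2 (hz k))
  have hd : 0 < ‖p j - p k‖ := norm_pos_iff.2 (sub_ne_zero.2 (hp.ne hjk))
  have h1 : 1 / ‖p j - p k‖ ≤ ∑ j, ∑ k, 1 / ‖p j - p k‖ :=
    (Finset.single_le_sum (f := fun k => 1 / ‖p j - p k‖) (fun _ _ => by positivity)
      (Finset.mem_univ k)).trans
    (Finset.single_le_sum (f := fun j => ∑ k, 1 / ‖p j - p k‖) (fun _ _ => by positivity)
      (Finset.mem_univ j))
  refine le_trans ?_ (mul_le_mul_of_nonneg_right h1 (by positivity))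
  have h2 : ‖p j - p k‖ ≤ ‖z - p j‖ + ‖z - p k‖ := by
    rw [← norm_neg (z - p j)]
    refine le_trans (le_of_eq ?_) (norm_add_le _ _)
    congr 1; ring
  rw [div_add_div _ _ hj.ne' hk.ne', div_mul_div_comm, div_mul_div_comm,
    div_le_div_iff₀ (by positivity) (by positivity)]
  have : 0 < ‖z - p j‖ * ‖z - p k‖ := by positivity
  nlinarith

namespace BoundaryFactorization

variable {Ω : Set ℂ} {g : ℂ → ℂ} {γ : ℝ → ℂ} {n : ℕ} (B : BoundaryFactorization Ω g γ n)

/-- The boundary points at which the competitor has its vortices. -/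
noncomputable def point (j : Fin n) : ℂ := γ (B.param j)

/-- The vortices, moved out of `Ω` by the distance `δ`. -/
noncomputable def shifted (δ : ℝ) (j : Fin n) : ℂ := B.point j - δ * B.dir j

/-- Moving the vortex against the inner normal makes the angle at `p j` nonacute in the triangle
with `z` and the vortex, so the cross term in the expanded square is nonnegative. -/
theorem norm_sub_shifted_sq_ge {δ : ℝ} (hδ : 0 ≤ δ) {z : ℂ} (hz : z ∈ closure Ω) (j : Fin n) :
    ‖z - B.point j‖ ^ 2 + δ ^ 2 ≤ ‖z - B.shifted δ j‖ ^ 2 := by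
  have h1 : z - B.shifted δ j = (z - B.point j) + δ • B.dir j := by
    rw [shifted, Complex.real_smul]; ring
  rw [h1, norm_add_sq_real, inner_smul_right, real_inner_comm, norm_smul, B.norm_dir, mul_one,
    Real.norm_eq_abs, sq_abs]
  have := mul_nonneg hδ (B.inner_nonneg j z hz)
  rw [point]
  linarith

noncomputable def competitor (ε δ : ℝ) : ℂ → ℂ := vortexProduct B.phase (B.shifted δ) ε

theorem contDiff_competitor {ε : ℝ} (hε : 0 < ε) (δ : ℝ) : ContDiff ℝ 1 (B.competitor ε δ) :=
  contDiff_vortexProduct B.contDiff_phase _ hε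

/-- The core size `η` is kept free: it is `ε` for vortices on the boundary and `δ` for vortices
moved out by `δ`. -/
theorem exists_energy_competitor_le (hΩ : IsOpen Ω) (hΩb : Bornology.IsBounded Ω)
    (hγΩ : ∀ t, γ t ∈ frontier Ω) :
    ∃ C : ℝ, ∀ (ε δ η : ℝ) (hε : 0 < ε), 0 ≤ δ → δ ≤ 1 → 0 < η → η ≤ 1 → η ^ 2 ≤ δ ^ 2 + ε ^ 2 →
      energy Ω ε (H1.ofContDiff hΩ.measurableSet hΩb _ (B.contDiff_competitor hε δ)) ≤
        ENNReal.ofReal (n * (Real.pi / 2) * |Real.log η| + C) := by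
  obtain ⟨R₀, hR₀⟩ := hΩb.closure.exists_norm_le
  obtain ⟨M, hM⟩ := hΩb.isCompact_closure.exists_bound_of_continuousOn
    (B.contDiff_phase.continuous_fderiv (by simp)).continuousOn
  obtain ⟨κ, hκ, hκT⟩ := exists_separation_bound B.injective
  have hfin := isFiniteMeasure_restrict_of_isBounded hΩb
  -- Points of `Ω` and the `p j` have norm at most `|R₀|`, and the shift is at most `1`; the
  -- remaining `1` makes the inclusion in the open ball strict.
  let R := 2 * |R₀| + 2
  have hR : 0 ≤ R := by positivity
  have hcl : ∀ t, γ t ∈ closure Ω := fun t => frontier_subset_closure (hγΩ t)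
  have hnorm : ∀ z ∈ closure Ω, ‖z‖ ≤ |R₀| := fun z hz => (hR₀ z hz).trans (le_abs_self _)
  have hM0 : 0 ≤ M := (norm_nonneg _).trans (hM _ (hcl 0))
  let k₁ := 2 * (4 * M + 8 * n * κ)
  let k₂ := 1 + (n : ℝ) / 2
  let μ := volume.restrict Ω
  refine ⟨1 / 2 * (n * (Real.pi / 2 * Real.log (R ^ 2 + 1)) + (2 * M ^ 2 * μ.real univ +
    (k₁ * (n * (2 * Real.pi * R)) + k₂ * (n * Real.pi)))), ?_⟩
  intro ε δ η hε hδ hδ1 hη hη1 hηle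
  have hball : ∀ j, ∀ δ' : ℝ, 0 ≤ δ' → δ' ≤ 1 → Ω ⊆ Metric.ball (B.shifted δ' j) R := by
    intro j δ' h0 h1 z hz
    rw [mem_ball_iff_norm, shifted]
    have e1 : ‖z - (B.point j - δ' * B.dir j)‖ ≤ ‖z‖ + ‖B.point j‖ + ‖(δ' : ℂ) * B.dir j‖ := by
      rw [show z - (B.point j - δ' * B.dir j) = z - B.point j + δ' * B.dir j by ring]
      exact (norm_add_le _ _).trans (by gcongr; exact norm_sub_le _ _)
    have e2 : ‖(δ' : ℂ) * B.dir j‖ ≤ 1 := by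
      rw [norm_mul, B.norm_dir, mul_one, Complex.norm_real, Real.norm_eq_abs, abs_of_nonneg h0]
      exact h1
    have e3 := hnorm z (subset_closure hz)
    have e4 := hnorm _ (hcl (B.param j))
    have e5 : ‖B.point j‖ ≤ |R₀| := e4
    simp only [R]
    linarith
  have hball0 : ∀ j, Ω ⊆ Metric.ball (B.point j) R := fun j => by
    have := hball j 0 le_rfl zero_le_one
    simpa [shifted] using this
  have hlog : Real.log ((R ^ 2 + η ^ 2) / η ^ 2) ≤ Real.log (R ^ 2 + 1) + 2 * |Real.log η| := by
    have hη2 : η ^ 2 ≤ 1 := pow_le_one₀ hη.le hη1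
    rw [Real.log_div (by positivity) (by positivity), Real.log_pow]
    have h1 : Real.log (R ^ 2 + η ^ 2) ≤ Real.log (R ^ 2 + 1) :=
      Real.log_le_log (by positivity) (by linarith)
    have h2 := neg_le_abs (Real.log η)
    push_cast
    linarith
  have hA : ∀ j, HasIntegralBound μ (fun z => 1 / (‖z - B.point j‖ ^ 2 + η ^ 2))
      (Real.pi / 2 * (Real.log (R ^ 2 + 1) + 2 * |Real.log η|)) := fun j =>
    { measurable := by fun_prop
      nonneg := by
        have : 0 ≤ Real.log (R ^ 2 + 1) := Real.log_nonneg (by nlinarith)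
        positivity
      le := (lintegral_halfPlane_inv_sq_add hΩ (B.norm_dir j)
        (fun z hz => B.inner_nonneg j z (subset_closure hz)) hη hR (hball0 j)).trans
        (ENNReal.ofReal_le_ofReal (by gcongr)) }
  have hT : ∀ j, HasIntegralBound μ (fun z => 1 / ‖z - B.point j‖) (2 * Real.pi * R) := fun j =>
    { measurable := by fun_prop
      nonneg := by positivity
      le := (lintegral_mono_set (hball0 j)).trans (lintegral_ball_inv_norm hR _) }
  have hP : ∀ j, HasIntegralBound μ
      (fun z => ε ^ 2 / (‖z - B.shifted δ j‖ ^ 2 + ε ^ 2) ^ 2) Real.pi := fun j =>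
    { measurable := by fun_prop
      nonneg := Real.pi_pos.le
      le := (lintegral_mono_set (hball j δ hδ hδ1)).trans (lintegral_ball_sq_div_sq_le hε hR _) }
  have hk₁ : 0 ≤ k₁ := by positivity
  have hk₂ : 0 ≤ k₂ := by positivity
  have hbound := ((HasIntegralBound.sum hA).add ((HasIntegralBound.const (μ := μ)
    (k := 2 * M ^ 2) (by positivity)).add (((HasIntegralBound.sum hT).const_mul hk₁).add
      ((HasIntegralBound.sum hP).const_mul hk₂))))
  have hle := hbound.le_of_ae_le (g := fun z => ‖fderiv ℝ (B.competitor ε δ) z 1‖ ^ 2 +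
    ‖fderiv ℝ (B.competitor ε δ) z Complex.I‖ ^ 2 +
      1 / (2 * ε ^ 2) * (1 - ‖B.competitor ε δ z‖ ^ 2) ^ 2) (by
    refine (ae_restrict_mem hΩ.measurableSet).mono fun z hz => ?_
    have hzp : ∀ j, z ≠ B.point j := by
      rintro j rfl
      have := hγΩ (B.param j)
      rw [frontier, hΩ.interior_eq] at this
      exact this.2 hz
    exact density_vortexProduct_le B.contDiff_phase hε hη hκ hzp (fun j => by
      have := B.norm_sub_shifted_sq_ge hδ (subset_closure hz) j
      linarith) (hM z (subset_closure hz)) (hκT z hzp))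
  rw [energy]
  refine (mul_le_mul_right hle _).trans ?_
  rw [← ENNReal.ofReal_mul (by norm_num)]
  apply ENNReal.ofReal_le_ofReal
  simp only [Finset.sum_const, Finset.card_univ, Fintype.card_fin, nsmul_eq_mul]
  apply le_of_eq
  ring

end BoundaryFactorization

/-! ### The boundary penalty of the competitor -/

theorem perpComp_eq_im (g w : ℂ) : perpComp g w = (w * (starRingEnd ℂ) g).im := by
  simp only [perpComp, inner_eq_re_im, Complex.mul_re, Complex.mul_im, Complex.I_re, Complex.I_im,
    Complex.conj_re, Complex.conj_im]
  ring

theorem abs_im_prod_le {ι : Type*} (s : Finset ι) {x : ι → ℂ} (hx : ∀ i, ‖x i‖ ≤ 1) :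
    |(∏ i ∈ s, x i).im| ≤ ∑ i ∈ s, |(x i).im| := by
  classical
  induction s using Finset.induction_on with
  | empty => simp
  | insert a s ha ih =>
    rw [Finset.prod_insert ha, Finset.sum_insert ha, Complex.mul_im]
    have h1 : |(∏ i ∈ s, x i).re| ≤ 1 := (Complex.abs_re_le_norm _).trans (by
      rw [norm_prod]; exact Finset.prod_le_one (fun _ _ => norm_nonneg _) fun i _ => hx i)
    have h2 : |(x a).re| ≤ 1 := (Complex.abs_re_le_norm _).trans (hx a)
    calc _ ≤ |(x a).re * (∏ i ∈ s, x i).im| + |(x a).im * (∏ i ∈ s, x i).re| := abs_add_le _ _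
      _ = |(x a).re| * |(∏ i ∈ s, x i).im| + |(x a).im| * |(∏ i ∈ s, x i).re| := by
          rw [abs_mul, abs_mul]
      _ ≤ 1 * ∑ i ∈ s, |(x i).im| + |(x a).im| * 1 := by gcongr
      _ = _ := by ring

/-- The integral of the Poisson type kernel `δ² / (c² (t - a)² + δ²)` over the line. -/
theorem lintegral_sq_div_sq_add_sq {c δ : ℝ} (hc : 0 < c) (hδ : 0 < δ) (a : ℝ) :
    ∫⁻ t : ℝ, ENNReal.ofReal (δ ^ 2 / ((c * |t - a|) ^ 2 + δ ^ 2)) =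
      ENNReal.ofReal (Real.pi / c * δ) := by
  have h0 : ∀ t : ℝ, δ ^ 2 / ((c * |t|) ^ 2 + δ ^ 2) = (1 + (c / δ * t) ^ 2)⁻¹ := fun t => by
    rw [mul_pow, sq_abs]
    have : c ^ 2 * t ^ 2 + δ ^ 2 ≠ 0 := by positivity
    have h2 : 1 + (c / δ * t) ^ 2 ≠ 0 := by positivity
    field_simp
    ring
  have hcδ : c / δ ≠ 0 := (div_pos hc hδ).ne'
  rw [lintegral_sub_right_eq_self (fun t : ℝ =>
    ENNReal.ofReal (δ ^ 2 / ((c * |t|) ^ 2 + δ ^ 2))) a]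
  simp only [h0]
  rw [← ofReal_integral_eq_lintegral_ofReal]
  · rw [Measure.integral_comp_mul_left (fun x : ℝ => (1 + x ^ 2)⁻¹), integral_univ_inv_one_add_sq,
      abs_of_pos (inv_pos.2 (div_pos hc hδ))]
    congr 1
    simp
    ring
  · exact (integrable_comp_mul_left_iff (fun x : ℝ => (1 + x ^ 2)⁻¹) hcδ).2
      integrable_inv_one_add_sq
  · exact Eventually.of_forall fun t => by positivity

namespace BoundaryFactorization

variable {Ω : Set ℂ} {g : ℂ → ℂ} {γ : ℝ → ℂ} {n : ℕ} (B : BoundaryFactorization Ω g γ n)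

/-- Multiplication by the conjugate of `g` cancels the phase and rotates the chord in each vortex
factor to the real axis. Only the displacement `δ * dir j` can have an imaginary part, and for `δ =
0` nothing is left. -/
theorem perpComp_competitor_sq_le {ε δ : ℝ} (hε : 0 < ε) (hδ : 0 ≤ δ) {t : ℝ}
    (ht : γ t ∈ closure Ω) :
    perpComp (g (γ t)) (B.competitor ε δ (γ t)) ^ 2 ≤
      n * ∑ j, δ ^ 2 / (‖γ t - B.point j‖ ^ 2 + δ ^ 2) := by
  let x : Fin n → ℂ := fun j =>
    vortex ε (γ t - B.shifted δ j) * (starRingEnd ℂ) (B.chordDir j t)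
  have hx : ∀ j, ‖x j‖ ≤ 1 := fun j => by
    simp only [x]
    rw [norm_mul, RCLike.norm_conj, B.norm_chordDir, mul_one]
    exact norm_vortex_le_one hε _
  have hprod : B.competitor ε δ (γ t) * (starRingEnd ℂ) (g (γ t)) = ∏ j, x j := by
    rw [B.map_eq, competitor, vortexProduct, map_mul, map_prod]
    simp only [x, Finset.prod_mul_distrib]
    have h1 : Complex.exp (B.phase (γ t) * Complex.I) *
        (starRingEnd ℂ) (Complex.exp (B.phase (γ t) * Complex.I)) = 1 := by
      rw [Complex.mul_conj, Complex.normSq_eq_norm_sq, Complex.norm_exp_ofReal_mul_I]; simp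
    linear_combination ((∏ j, vortex ε (γ t - B.shifted δ j)) *
      ∏ j, (starRingEnd ℂ) (B.chordDir j t)) * h1
  have him : ∀ j, |(x j).im| ^ 2 ≤ δ ^ 2 / (‖γ t - B.point j‖ ^ 2 + δ ^ 2) := by
    intro j
    obtain ⟨r, hr⟩ := B.chord_eq j t
    have hN := norm_sq_add_sq_pos hε (γ t - B.shifted δ j)
    have hge := B.norm_sub_shifted_sq_ge hδ ht j
    set S := (√(‖γ t - B.shifted δ j‖ ^ 2 + ε ^ 2))⁻¹ with hS
    have hq : B.chordDir j t * (starRingEnd ℂ) (B.chordDir j t) = 1 := by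
      rw [Complex.mul_conj, Complex.normSq_eq_norm_sq, B.norm_chordDir]; simp
    have hx1 : x j = ((S * r : ℝ) : ℂ) +
        ((S * δ : ℝ) : ℂ) * (B.dir j * (starRingEnd ℂ) (B.chordDir j t)) := by
      have e1 : γ t - B.shifted δ j = r * B.chordDir j t + δ * B.dir j := by
        rw [← hr, shifted, point]; ring
      simp only [x, vortex, ← hS, Complex.real_smul]
      rw [e1]
      push_cast
      linear_combination (S * r : ℂ) * hq
    have h2 : |(x j).im| ≤ S * δ := by
      rw [hx1, Complex.add_im, Complex.ofReal_im, zero_add, Complex.im_ofReal_mul, abs_mul,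
        abs_of_nonneg (by positivity : 0 ≤ S * δ)]
      refine mul_le_of_le_one_right (by positivity) ((Complex.abs_im_le_norm _).trans ?_)
      rw [norm_mul, RCLike.norm_conj, B.norm_chordDir, B.norm_dir, mul_one]
    refine (pow_le_pow_left₀ (abs_nonneg _) h2 2).trans ?_
    rw [mul_pow, hS, inv_pow, Real.sq_sqrt hN.le, inv_mul_eq_div]
    rcases hδ.eq_or_lt with rfl | hδ
    · simp
    · exact div_le_div_of_nonneg_left (by positivity) (by positivity) (by nlinarith)
  rw [perpComp_eq_im, hprod, ← sq_abs]
  have h3 := sq_sum_le_card_mul_sum_sq (s := Finset.univ) (f := fun j => |(x j).im|)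
  rw [Finset.card_univ, Fintype.card_fin] at h3
  refine (pow_le_pow_left₀ (abs_nonneg _) (abs_im_prod_le Finset.univ hx) 2).trans (h3.trans ?_)
  gcongr
  exact him _

/-- Chords are bounded below linearly in the parameter, so each kernel is dominated by a Poisson
type kernel on the line, whose integral is proportional to `δ`. -/
theorem exists_boundary_term_le (hγ : ContDiff ℝ 1 γ) (hper : Function.Periodic γ 1)
    (hrange : range γ = frontier Ω) :
    ∃ C : ℝ, 0 ≤ C ∧ ∀ ε δ : ℝ, 0 < ε → 0 < δ →
      ∫⁻ z, ENNReal.ofReal (perpComp (g z) (B.competitor ε δ z) ^ 2) ∂(bdryMeasure Ω) ≤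
        ENNReal.ofReal (C * δ) := by
  obtain ⟨K, hK⟩ := exists_bdryMeasure_le hγ hper hrange
  choose c hc hcl using B.chord_lower
  refine ⟨n * ∑ j, K * (Real.pi / c j), mul_nonneg (by positivity) (Finset.sum_nonneg fun j _ =>
    mul_nonneg K.2 (div_nonneg Real.pi_pos.le (hc j).le)), fun ε δ hε hδ => ?_⟩
  have hj : ∀ j, HasIntegralBound (bdryMeasure Ω)
      (fun z => δ ^ 2 / (‖z - B.point j‖ ^ 2 + δ ^ 2)) (K * (Real.pi / c j * δ)) := fun j =>
    { measurable := by fun_prop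
      nonneg := mul_nonneg K.2 (mul_nonneg (div_nonneg Real.pi_pos.le (hc j).le) hδ.le)
      le := by
        have hm : Measurable fun z : ℂ =>
            ENNReal.ofReal (δ ^ 2 / (‖z - B.point j‖ ^ 2 + δ ^ 2)) := by fun_prop
        refine (lintegral_mono' (hK (B.param j - 1 / 2)) le_rfl).trans ?_
        rw [lintegral_smul_measure, lintegral_map hm hγ.continuous.measurable, smul_eq_mul,
          ENNReal.ofReal_mul K.coe_nonneg, ENNReal.ofReal_coe_nnreal,
          ← lintegral_sq_div_sq_add_sq (hc j) hδ (B.param j)]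
        refine mul_le_mul_right ((setLIntegral_mono' measurableSet_Ioc fun t ht => ?_).trans
          (setLIntegral_le_lintegral _ _)) _
        apply ENNReal.ofReal_le_ofReal
        have h1 := hcl j t (abs_le.2 ⟨by linarith [ht.1], by linarith [ht.2]⟩)
        have h2 : 0 ≤ c j * |t - B.param j| := mul_nonneg (hc j).le (abs_nonneg _)
        refine div_le_div_of_nonneg_left (by positivity) (by positivity) ?_
        have := pow_le_pow_left₀ h2 h1 2
        rw [point]
        linarith }
  have hb := (HasIntegralBound.sum hj).const_mul (k := n) (by positivity)
  refine (hb.le_of_ae_le ?_).trans (ENNReal.ofReal_le_ofReal (le_of_eq ?_))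
  · refine (ae_restrict_mem isClosed_frontier.measurableSet).mono fun z hz => ?_
    have hz' := hz
    rw [← hrange] at hz'
    obtain ⟨t, rfl⟩ := hz'
    exact B.perpComp_competitor_sq_le hε hδ.le (frontier_subset_closure hz)
  · rw [mul_assoc, Finset.sum_mul]
    simp only [mul_assoc]

end BoundaryFactorization

/-! ### Comparison with the minimizers -/

theorem energy_zero_le {Ω : Set ℂ} (hΩm : MeasurableSet Ω) (hΩ : Bornology.IsBounded Ω) {ε : ℝ}
    (hε : 1 ≤ ε) :
    energy Ω ε (H1.ofContDiff hΩm hΩ (fun _ => 0) contDiff_const) ≤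
      ENNReal.ofReal ((volume.restrict Ω).real univ) := by
  have hfin := isFiniteMeasure_restrict_of_isBounded hΩ
  have h1 : 1 / (2 * ε ^ 2) ≤ 1 := by
    rw [div_le_one (by positivity)]; nlinarith
  have hle := (HasIntegralBound.const (μ := volume.restrict Ω) zero_le_one).le_of_ae_le
    (g := fun _ => 1 / (2 * ε ^ 2)) (Eventually.of_forall fun _ => h1)
  rw [one_mul] at hle
  have h2 : ENNReal.ofReal (1 / 2) ≤ 1 := ENNReal.ofReal_le_one.2 (by norm_num)
  refine (mul_le_mul' h2 (le_trans (le_of_eq ?_) hle)).trans (one_mul _).le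
  simp [H1.ofContDiff]

theorem perpComp_zero (g : ℂ) : perpComp g 0 = 0 := by simp [perpComp]

end TangentialGL

theorem proposition2p2 (α : ℝ≥0) (hα0 : 0 < α) (hα1 : α ≤ 1)
    (Ω : Set ℂ) (hΩ_open : IsOpen Ω) (hΩ_bdd : Bornology.IsBounded Ω)
    (hΩ_sc : IsSimplyConnected Ω) (hΩ_bdry : TangentialGL.HasC3HolderBoundary α Ω)
    (g : ℂ → ℂ) (hg : TangentialGL.IsC3HolderCircleMap α (frontier Ω) g)
    (D : ℤ) (hdeg : TangentialGL.HasBoundaryDegree α Ω g D) (hD : 0 < D) :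
    (∃ C : ℝ, 0 < C ∧ ∀ ε : ℝ, 0 < ε → ∀ u : TangentialGL.H1 Ω,
      TangentialGL.IsStrongMinimizer Ω g ε u →
        TangentialGL.energy Ω ε u ≤ ENNReal.ofReal (Real.pi * D * |Real.log ε| + C)) ∧
    (∀ s : ℝ, 0 < s → s ≤ 1 → ∃ C : ℝ, 0 < C ∧ ∀ ε : ℝ, 0 < ε →
      ∀ (u : TangentialGL.H1 Ω) (T : ℂ → ℂ), TangentialGL.IsWeakMinimizer Ω g s ε u T →
        TangentialGL.weakEnergy Ω g s ε u T ≤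
          ENNReal.ofReal (Real.pi * s * D * |Real.log ε| + C)) := by
  open TangentialGL in
  obtain ⟨γ, θ, hγ, hθ, hgθ, hθD⟩ := hdeg
  lift D to ℕ using hD.le
  rw [Int.cast_natCast] at hθD ⊢
  obtain ⟨B⟩ := exists_boundaryFactorization hΩ_open hΩ_bdd hg hγ hθ hgθ hθD
  have hγ1 : ContDiff ℝ 1 γ := hγ.smooth.1.of_le (by norm_num)
  have hγΩ : ∀ t, γ t ∈ frontier Ω := fun t => hγ.range_eq ▸ mem_range_self t
  have hfin := isFiniteMeasure_bdryMeasure hγ1 hγ.periodic hγ.range_eq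
  obtain ⟨C₁, hC₁⟩ := B.exists_energy_competitor_le hΩ_open hΩ_bdd hγΩ
  obtain ⟨C₂, hC₂0, hC₂⟩ := B.exists_boundary_term_le hγ1 hγ.periodic hγ.range_eq
  have hΩm := hΩ_open.measurableSet
  set V := (volume.restrict Ω).real univ
  have hV : 0 ≤ V := measureReal_nonneg
  have hzero := isTrace_ofContDiff hΩm hΩ_bdd (fun _ => 0) contDiff_const
  have hC₁' := le_abs_self C₁
  have hC₁0 := abs_nonneg C₁
  have hπ := Real.pi_pos
  refine ⟨⟨|C₁| + V + 1, by linarith, fun ε hε u hu => ?_⟩, fun s hs _ =>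
    ⟨|C₁| + 1 / 2 * C₂ + V + 1, by linarith, fun ε hε u T hu => ?_⟩⟩
  · rcases le_or_gt 1 ε with h1 | h1
    -- For `ε ≥ 1` the zero map is admissible and has bounded energy, while the logarithmic term on
    -- the right is nonnegative.
    · refine (hu.2 _ ⟨_, hzero, ?_⟩).trans ((energy_zero_le hΩm hΩ_bdd h1).trans
        (ENNReal.ofReal_le_ofReal ?_))
      · simp [perpComp_zero]
      · have : 0 ≤ Real.pi * D * |Real.log ε| := by positivity
        linarith
    -- Vortices on the boundary: `δ = 0` and `η = ε`.
    · refine (hu.2 _ ⟨_, isTrace_ofContDiff hΩm hΩ_bdd _ (B.contDiff_competitor hε 0), ?_⟩).trans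
        ((hC₁ ε 0 ε hε le_rfl zero_le_one hε h1.le (by simp)).trans
          (ENNReal.ofReal_le_ofReal ?_))
      · refine (ae_restrict_mem isClosed_frontier.measurableSet).mono fun z hz => ?_
        have hz' := hz
        rw [← hγ.range_eq] at hz'
        obtain ⟨t, rfl⟩ := hz'
        have h2 := B.perpComp_competitor_sq_le hε le_rfl (frontier_subset_closure hz)
        simp only [ne_eq, OfNat.ofNat_ne_zero, not_false_eq_true, zero_pow, zero_div,
          Finset.sum_const_zero, mul_zero] at h2
        exact pow_eq_zero_iff two_ne_zero |>.1 (le_antisymm h2 (sq_nonneg _))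
      · have : (2 * D : ℕ) * (Real.pi / 2) * |Real.log ε| = Real.pi * D * |Real.log ε| := by
          push_cast; ring
        linarith
  · rcases le_or_gt 1 ε with h1 | h1
    · refine (hu.2 _ _ hzero).trans ?_
      simp only [weakEnergy, perpComp_zero, ne_eq, OfNat.ofNat_ne_zero, not_false_eq_true,
        zero_pow, ENNReal.ofReal_zero, lintegral_zero, mul_zero, add_zero]
      refine (energy_zero_le hΩm hΩ_bdd h1).trans (ENNReal.ofReal_le_ofReal ?_)
      have : 0 ≤ Real.pi * s * D * |Real.log ε| := by positivity
      linarith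
    -- Vortices moved out by `δ = ε^s`, with core size `η = δ`: the largest scale for which the
    -- penalty stays bounded.
    · have hδ : 0 < ε ^ s := Real.rpow_pos_of_pos hε s
      have hδ1 : ε ^ s ≤ 1 := Real.rpow_le_one hε.le h1.le hs.le
      refine (hu.2 _ _ (isTrace_ofContDiff hΩm hΩ_bdd _ (B.contDiff_competitor hε (ε ^ s)))).trans ?_
      have h2 := hC₁ ε (ε ^ s) (ε ^ s) hε hδ.le hδ1 hδ hδ1 (by nlinarith [sq_nonneg ε])
      have h3 := hC₂ ε (ε ^ s) hε hδ
      rw [Real.log_rpow hε, abs_mul, abs_of_pos hs] at h2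
      have h4 : ENNReal.ofReal (1 / (2 * ε ^ s)) * ENNReal.ofReal (C₂ * ε ^ s) =
          ENNReal.ofReal (1 / 2 * C₂) := by
        rw [← ENNReal.ofReal_mul (by positivity)]
        congr 1
        field_simp
      have h5 : ENNReal.ofReal ((2 * D : ℕ) * (Real.pi / 2) * (s * |Real.log ε|) + C₁) ≤
          ENNReal.ofReal (Real.pi * s * D * |Real.log ε| + |C₁|) := by
        apply ENNReal.ofReal_le_ofReal
        have : (2 * D : ℕ) * (Real.pi / 2) * (s * |Real.log ε|) =
          Real.pi * s * D * |Real.log ε| := by push_cast; ring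
        linarith
      have h6 : 0 ≤ Real.pi * s * D * |Real.log ε| := by positivity
      calc _ ≤ ENNReal.ofReal (Real.pi * s * D * |Real.log ε| + |C₁|) +
            ENNReal.ofReal (1 / (2 * ε ^ s)) * ENNReal.ofReal (C₂ * ε ^ s) :=
            add_le_add (h2.trans h5) (mul_le_mul_right h3 _)
        _ = ENNReal.ofReal (Real.pi * s * D * |Real.log ε| + |C₁| + 1 / 2 * C₂) := by
            rw [h4, ← ENNReal.ofReal_add (by linarith) (by linarith)]
        _ ≤ _ := ENNReal.ofReal_le_ofReal (by linarith)
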